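/- **Theorem (Jacobi–Trudi formulas for skew Schur multiple zeta functions).** Let $\lambda=(\lambda_1,\dots,\lambda_r)$ and $\mu=(\mu_1,\dots,\mu_r)$ be partitions, with zero parts allowed, such that $\mu\subset\lambda\subset(q^r)$, and let $\lambda'=(\lambda'_1,\dots,\lambda'_q)$ and $\mu'=(\mu'_1,\dots,\mu'_q)$ be their conjugates (zero parts again allowed). Let $D=D(\lambda/\mu)=\{(i,j): 1\le i\le r,\ \mu_i<j\le\lambda_i\}$. A box $(i,j)\in D$ is a corner if $(i+1,j)\notin D$ and $(i,j+1)\notin D$. Let $\mathrm{SSYT}(\lambda/\mu)$ be the set of fillings $M=(m_{ij})_{(i,j)\in D}$ of $D$ by positive integers that increase weakly along rows and strictly down columns. For a complex filling $\boldsymbol s=(s_{ij})_{(i,j)\in D}$ put $$\zeta_{\lambda/\mu}(\boldsymbol s)=\sum_{M\in\mathrm{SSYT}(\lambda/\mu)}\ \prod_{(i,j)\in D}m_{ij}^{-s_{ij}},$$ and let $$\zeta(s_1,\dots,s_n)=\sum_{1\le m_1<\dots<m_n}\prod_k m_k^{-s_k},\qquad \zeta^\star(s_1,\dots,s_n)=\sum_{1\le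 m_1\le\dots\le m_n}\prod_k m_k^{-s_k}.$$ Let $W^{\mathrm{diag}}_{\lambda/\mu}$ be the set of those $\boldsymbol s$ for which $\Re(s_{ij})\ge1$ at every box of $D$ that is not a corner, $\Re(s_{ij})>1$ at every corner, and $s_{ij}=s_{kl}$ whenever $j-i=l-k$. For $\boldsymbol s\in W^{\mathrm{diag}}_{\lambda/\mu}$ write $a_{j-i}=s_{ij}$ for $(i,j)\in D$, and let $a_k\in\mathbb C$ be arbitrary if $k\in\mathbb Z$ is not of the form $j-i$ with $(i,j)\in D$. Let $\boldsymbol s\in W^{\mathrm{diag}}_{\lambda/\mu}$. Then the series $\zeta_{\lambda/\mu}(\boldsymbol s)$ converges absolutely, and the following hold. 1. If $\Re(s_{i,\lambda_i})>1$ for all $i$ with $(i,\lambda_i)\in D$, then $$\zeta_{\lambda/\mu}(\boldsymbol s)=\det\bigl[\zeta^\star(a_{\mu_j-j+1},a_{\mu_j-j+2},\dots,a_{\mu_j-j+(\lambda_i-\mu_j-i+j)})\bigr]_{1\le i,j\le r},$$ where $\zeta^\star(\cdots)$ is understood to be $1$ if $\lambda_i-\mu_j-i+j=0$ and $0$ if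 $\lambda_i-\mu_j-i+j<0$. 2. If $\Re(s_{\lambda'_i,i})>1$ for all $i$ with $(\lambda'_i,i)\in D$, then $$\zeta_{\lambda/\mu}(\boldsymbol s)=\det\bigl[\zeta(a_{-\mu'_j+j-1},a_{-\mu'_j+j-2},\dots,a_{-\mu'_j+j-(\lambda'_i-\mu'_j-i+j)})\bigr]_{1\le i,j\le q},$$ where $\zeta(\cdots)$ is understood to be $1$ if $\lambda'_i-\mu'_j-i+j=0$ and $0$ if $\lambda'_i-\mu'_j-i+j<0$. In both cases each entry all of whose arguments $a_k$ have an index $k$ of the form $j'-i'$ with $(i',j')\in D$ converges absolutely. The series in the remaining entries may diverge; in the determinant, a series that does not converge absolutely is given the value $0$. -/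

import Mathlib

namespace SkewSchurZeta

/-- The boxes of the skew diagram `D(lam/mu)`. As everywhere for Mathlib's `YoungDiagram`, rows and
columns are numbered from `0`: the box written `(i, j)` with `i, j ≥ 1` is `(i - 1, j - 1)` here. -/
def skewCells (lam mu : YoungDiagram) : Finset (ℕ × ℕ) := lam.cells \ mu.cells

/-- `T(lam/mu, X)`: the fillings of the boxes of `lam/mu` with elements of `X`. -/
abbrev SkewTableau (lam mu : YoungDiagram) (X : Type*) : Type _ :=
  {b : ℕ × ℕ // b ∈ skewCells lam mu} → X

/-- The content `j - i` of a box (the same number for both ways of numbering). It labels the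
diagonal on which the box lies. -/
def content (b : ℕ × ℕ) : ℤ := (b.2 : ℤ) - (b.1 : ℤ)

/-- Semi-standard: a filling by positive integers, weakly increasing along each row from left to
right and strictly increasing down each column. -/
def IsSemistandard {lam mu : YoungDiagram} (M : SkewTableau lam mu ℕ+) : Prop :=
  (∀ b c : {b : ℕ × ℕ // b ∈ skewCells lam mu},
    b.1.1 = c.1.1 → b.1.2 < c.1.2 → M b ≤ M c) ∧
  (∀ b c : {b : ℕ × ℕ // b ∈ skewCells lam mu},
    b.1.2 = c.1.2 → b.1.1 < c.1.1 → M b < M c)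

/-- `SSYT(lam/mu)`. -/
abbrev SSYT (lam mu : YoungDiagram) : Type :=
  {M : SkewTableau lam mu ℕ+ // IsSemistandard M}

/-- The term `1 / M ^ s`, where `M ^ s` is the product of all `m_{ij} ^ {s_{ij}}`. -/
noncomputable def schurTerm {lam mu : YoungDiagram} (s : SkewTableau lam mu ℂ)
    (M : SSYT lam mu) : ℂ :=
  1 / ∏ b, ((M.1 b : ℕ) : ℂ) ^ (s b)

/-- The skew Schur multiple zeta function `ζ_{lam/mu}(s)`. -/
noncomputable def schurZeta {lam mu : YoungDiagram} (s : SkewTableau lam mu ℂ) : ℂ :=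
  ∑' M : SSYT lam mu, schurTerm s M

/-- A corner of `lam/mu`: a box of `lam/mu` with no box of `lam/mu` directly below it or directly
to its right. -/
def IsCorner (lam mu : YoungDiagram) (b : ℕ × ℕ) : Prop :=
  b ∈ skewCells lam mu ∧ (b.1 + 1, b.2) ∉ skewCells lam mu ∧ (b.1, b.2 + 1) ∉ skewCells lam mu

/-- `W_{lam/mu}`. -/
def convergenceRegion (lam mu : YoungDiagram) : Set (SkewTableau lam mu ℂ) :=
  {s | (∀ b, ¬ IsCorner lam mu b.1 → 1 ≤ (s b).re) ∧ (∀ b, IsCorner lam mu b.1 → 1 < (s b).re)}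

/-- `T^diag(lam/mu, X)`: the fillings that are constant on diagonals. -/
def diagTableaux (lam mu : YoungDiagram) (X : Type*) : Set (SkewTableau lam mu X) :=
  {t | ∀ b c, content b.1 = content c.1 → t b = t c}

/-- `W^diag_{lam/mu}`. -/
def diagConvergenceRegion (lam mu : YoungDiagram) : Set (SkewTableau lam mu ℂ) :=
  convergenceRegion lam mu ∩ diagTableaux lam mu ℂ

/-- The term `1 / (m_1 ^ {s_1} ⋯ m_n ^ {s_n})`. -/
noncomputable def powTerm {n : ℕ} (s : Fin n → ℂ) (m : Fin n → ℕ+) : ℂ :=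
  1 / ∏ k, ((m k : ℕ) : ℂ) ^ (s k)

/-- The multiple zeta function `ζ(s_1, …, s_n)`, summed over `0 < m_1 < ⋯ < m_n`. -/
noncomputable def mzeta {n : ℕ} (s : Fin n → ℂ) : ℂ :=
  ∑' m : {m : Fin n → ℕ+ // StrictMono m}, powTerm s m.1

/-- The multiple zeta-star function `ζ⋆(s_1, …, s_n)`, summed over `0 < m_1 ≤ ⋯ ≤ m_n`. -/
noncomputable def mzetaStar {n : ℕ} (s : Fin n → ℂ) : ℂ :=
  ∑' m : {m : Fin n → ℕ+ // Monotone m}, powTerm s m.1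

/-- Absolute convergence of the series of `mzeta s`. -/
def MzetaConverges {n : ℕ} (s : Fin n → ℂ) : Prop :=
  Summable fun m : {m : Fin n → ℕ+ // StrictMono m} => ‖powTerm s m.1‖

/-- Absolute convergence of the series of `mzetaStar s`. -/
def MzetaStarConverges {n : ℕ} (s : Fin n → ℂ) : Prop :=
  Summable fun m : {m : Fin n → ℕ+ // Monotone m} => ‖powTerm s m.1‖

/-- The tuple `(a_c, a_{c+1}, …, a_{c+l-1})`; it is empty for `l ≤ 0`. -/
def ascTuple (a : ℤ → ℂ) (c l : ℤ) : Fin l.toNat → ℂ := fun k => a (c + (k : ℕ))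

/-- The tuple `(a_c, a_{c-1}, …, a_{c-l+1})`; it is empty for `l ≤ 0`. -/
def descTuple (a : ℤ → ℂ) (c l : ℤ) : Fin l.toNat → ℂ := fun k => a (c - (k : ℕ))

/-- `ζ⋆(a_c, …, a_{c+l-1})`, with the convention that it is `1` for `l = 0` and `0` for `l < 0`. -/
noncomputable def starEntry (a : ℤ → ℂ) (c l : ℤ) : ℂ :=
  if l < 0 then 0 else if l = 0 then 1 else mzetaStar (ascTuple a c l)

/-- `ζ(a_c, a_{c-1}, …, a_{c-l+1})`, with the convention that it is `1` for `l = 0` and `0` for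
`l < 0`. -/
noncomputable def zetaEntry (a : ℤ → ℂ) (c l : ℤ) : ℂ :=
  if l < 0 then 0 else if l = 0 then 1 else mzeta (descTuple a c l)

/-- The length `lam_i - mu_j - i + j`. -/
def rowLength (lam mu : YoungDiagram) (i j : ℕ) : ℤ :=
  (lam.rowLen i : ℤ) - (mu.rowLen j : ℤ) - (i : ℤ) + (j : ℤ)

/-- The length `lam'_i - mu'_j - i + j`. -/
def colLength (lam mu : YoungDiagram) (i j : ℕ) : ℤ :=
  (lam.colLen i : ℤ) - (mu.colLen j : ℤ) - (i : ℤ) + (j : ℤ)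

/-- The first index `mu_j - j + 1` (rows numbered from `1`) of the tuples in the `j`-th column of
the `H`-type matrix; it is `mu_j - j` when rows are numbered from `0`. -/
def rowStart (mu : YoungDiagram) (j : ℕ) : ℤ := (mu.rowLen j : ℤ) - (j : ℤ)

/-- The first index `-mu'_j + j - 1` (columns numbered from `1`) of the tuples in the `j`-th column
of the `E`-type matrix; it is `-mu'_j + j` when columns are numbered from `0`. -/
def colStart (mu : YoungDiagram) (j : ℕ) : ℤ := -(mu.colLen j : ℤ) + (j : ℤ)

/-- The `H`-type Jacobi-Trudi matrix, of size `r`. -/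
noncomputable def hMatrix (lam mu : YoungDiagram) (r : ℕ) (a : ℤ → ℂ) :
    Matrix (Fin r) (Fin r) ℂ :=
  Matrix.of fun i j => starEntry a (rowStart mu j) (rowLength lam mu i j)

/-- The `E`-type Jacobi-Trudi matrix, of size `q`. -/
noncomputable def eMatrix (lam mu : YoungDiagram) (q : ℕ) (a : ℤ → ℂ) :
    Matrix (Fin q) (Fin q) ℂ :=
  Matrix.of fun i j => zetaEntry a (colStart mu j) (colLength lam mu i j)

/-- `k` is the content of some box of `lam/mu`, so that `a_k` is determined by the tableau. -/
def IsContent (lam mu : YoungDiagram) (k : ℤ) : Prop :=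
  ∃ b ∈ skewCells lam mu, content b = k

end SkewSchurZeta

/-!
The Jacobi-Trudi formulas are first proved for fillings with entries at most `N`, where everything is
a finite sum and no convergence is needed, and then `N` tends to infinity.

**Bounded entries.** For a shape `la/mu` the boxes containing the largest allowed value `N` form a
horizontal strip `la/nu`, and what remains is a filling of `nu/mu` with smaller entries
(`boxSum_succ`, `shapeSum_row_col_succ`). Removing the copies of `N` from a single weakly increasing
row shows that the row of the `H`-type matrix with index `i` is, up to a multiple of the next row, a
linear combination of rows for the bound `N - 1`, which belong to the possible lengths `nu i` with
`la (i + 1) ≤ nu i ≤ la i`. Expanding the determinant multilinearly gives the same recursion as for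
the fillings, since the determinant vanishes unless `mu ≤ nu` (`shapeSum_eq_det_weak`). The `E`-type
formula is the same statement for the transposed shape, with the roles of weak and strict inequality
exchanged: horizontal strips become vertical strips, and the terms of the expansion which do not
correspond to a vertical strip have two equal rows (`shapeSum_eq_det_strict`). Both arguments allow an
arbitrary weight depending on the value and the content of a box.

**Convergence.** Each entry of a filling is bounded by the entry in a corner, where the exponent has
real part greater than `1`. Distributing the excess at the corners over all boxes bounds the series by
a product of convergent series `∑ m ^ (-1 - ε)` (`summable_of_le_excess`). Multiple zeta values are the
case of a single row.

**Limit.** A matrix entry all of whose indices are contents of `la/mu` converges, because its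
last index is the content of the end of a row (or column). If an entry involves
an index `k` which is not a content, then `k` separates the rows of `la/mu` into those with larger and
those with smaller contents, the matrix is block triangular, and the entry lies in the block which does
not affect the determinant, whatever its value (`det_congr_of_gap`).
-/

namespace SkewSchurZeta

/-! ### Fillings subject to weak and strict inequalities -/

section Fillings

variable {ι κ β R : Type*} [CommRing R]

/-- A filling `M` weakly increases along the relation `W` and strictly along the relation `S`. -/
def Compatible {X : Type*} [Preorder X] (W S : ι → ι → Prop) (M : ι → X) : Prop :=
  (∀ b c, W b c → M b ≤ M c) ∧ ∀ b c, S b c → M b < M c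

open Classical in
/-- The generating function of the compatible fillings by `0, …, N - 1`, where the value `m` in the
box `b` has weight `y m b`. -/
noncomputable def fillSum [Fintype ι] [DecidableEq ι] (W S : ι → ι → Prop) (y : ℕ → ι → R)
    (N : ℕ) : R :=
  ∑ M : ι → Fin N, if Compatible W S M then ∏ b, y (M b) b else 0

lemma fillSum_congr [Fintype ι] [DecidableEq ι] [Fintype κ] [DecidableEq κ] (e : ι ≃ κ)
    {W S : ι → ι → Prop} {W' S' : κ → κ → Prop} {y : ℕ → ι → R} {y' : ℕ → κ → R}
    (hW : ∀ b c, W b c ↔ W' (e b) (e c)) (hS : ∀ b c, S b c ↔ S' (e b) (e c))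
    (hy : ∀ m b, y m b = y' m (e b)) (N : ℕ) : fillSum W S y N = fillSum W' S' y' N := by
  classical
  unfold fillSum
  refine Fintype.sum_equiv (e.arrowCongr (Equiv.refl _)) _ _ fun M => ?_
  have h1 : Compatible W S M ↔ Compatible W' S' ((e.arrowCongr (Equiv.refl _)) M) := by
    unfold Compatible
    simp [e.forall_congr_left, hW, hS]
  have h2 : ∏ b, y (M b) b = ∏ b, y' ((e.arrowCongr (Equiv.refl (Fin N))) M b : Fin N) b :=
    Fintype.prod_equiv e _ _ fun b => by simp [hy]
  rw [h2]
  exact if_congr h1 rfl rfl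

/-- `fillSum` for the boxes of a finite set, with relations and weights given on all boxes. -/
noncomputable def boxSum [DecidableEq β] (W S : β → β → Prop) (y : ℕ → β → R) (B : Finset β)
    (N : ℕ) : R :=
  fillSum (ι := B) (fun b c => W b.1 c.1) (fun b c => S b.1 c.1) (fun m b => y m b.1) N

/-- The condition on `T ⊆ B` under which every compatible filling of `T` by smaller values remains
compatible when the boxes of `B` outside `T` are filled with the largest allowed value. -/
def IsLevelSet (W S : β → β → Prop) (B T : Finset β) : Prop :=
  (∀ b ∈ B, ∀ c ∈ T, W b c → b ∈ T) ∧ ∀ b ∈ B, ∀ c ∈ B, S b c → b ∈ T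

/-- The extension of a filling of `T ⊆ B` to `B` by the new largest value. -/
noncomputable def extendFilling [DecidableEq β] {B T : Finset β} {N : ℕ} (M : T → Fin N) :
    B → Fin (N + 1) :=
  fun b => if h : b.1 ∈ T then (M ⟨b.1, h⟩).castSucc else Fin.last N

lemma compatible_extendFilling [DecidableEq β] {W S : β → β → Prop} {B T : Finset β}
    (hT : T ⊆ B) {N : ℕ} (M : T → Fin N) :
    Compatible (fun b c : B => W b.1 c.1) (fun b c => S b.1 c.1) (extendFilling M) ↔
      IsLevelSet W S B T ∧
        Compatible (fun b c : T => W b.1 c.1) (fun b c => S b.1 c.1) M := by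
  constructor
  · rintro ⟨h1, h2⟩
    refine ⟨⟨fun b hb c hc hbc => ?_, fun b hb c hc hbc => ?_⟩, fun b c hbc => ?_,
      fun b c hbc => ?_⟩
    · by_contra hbT
      have := h1 ⟨b, hb⟩ ⟨c, hT hc⟩ hbc
      simp only [extendFilling, hbT, hc, dif_pos, dif_neg, not_false_eq_true] at this
      exact absurd this (not_le.2 (Fin.castSucc_lt_last _))
    · by_contra hbT
      have := h2 ⟨b, hb⟩ ⟨c, hc⟩ hbc
      simp only [extendFilling, hbT, dif_neg, not_false_eq_true] at this
      exact absurd this (not_lt.2 (Fin.le_last _))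
    · have := h1 ⟨b.1, hT b.2⟩ ⟨c.1, hT c.2⟩ hbc
      simpa [extendFilling] using this
    · have := h2 ⟨b.1, hT b.2⟩ ⟨c.1, hT c.2⟩ hbc
      simpa [extendFilling] using this
  · rintro ⟨⟨h1, h2⟩, h3, h4⟩
    refine ⟨fun b c hbc => ?_, fun b c hbc => ?_⟩
    · by_cases hc : c.1 ∈ T
      · have hb := h1 b.1 b.2 c.1 hc hbc
        simpa [extendFilling, hb, hc] using h3 ⟨b.1, hb⟩ ⟨c.1, hc⟩ hbc
      · simp only [extendFilling, hc, dif_neg, not_false_eq_true]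
        exact Fin.le_last _
    · have hb := h2 b.1 b.2 c.1 c.2 hbc
      by_cases hc : c.1 ∈ T
      · simpa [extendFilling, hb, hc] using h4 ⟨b.1, hb⟩ ⟨c.1, hc⟩ hbc
      · simp only [extendFilling, hb, hc, dif_pos, dif_neg, not_false_eq_true]
        exact Fin.castSucc_lt_last _

lemma prod_extendFilling [DecidableEq β] {B T : Finset β} (hT : T ⊆ B) {N : ℕ}
    (y : ℕ → β → R) (M : T → Fin N) :
    ∏ b : B, y (extendFilling M b : Fin (N + 1)) b.1 =
      (∏ b : T, y (M b) b.1) * ∏ b ∈ B \ T, y N b := by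
  let g : β → R := fun b => if h : b ∈ T then y (M ⟨b, h⟩) b else y N b
  have h1 : ∀ b : B, y (extendFilling M b : Fin (N + 1)) b.1 = g b.1 := by
    intro b
    by_cases h : b.1 ∈ T <;> simp [extendFilling, g, h]
  have h2 : ∀ b : T, y (M b) b.1 = g b.1 := fun b => by simp [g]
  have h3 : ∏ b ∈ B \ T, y N b = ∏ b ∈ B \ T, g b :=
    Finset.prod_congr rfl fun b hb => by simp [g, (Finset.mem_sdiff.1 hb).2]
  simp only [h1, h2, h3]
  rw [Finset.prod_coe_sort B g, Finset.prod_coe_sort T g, mul_comm, Finset.prod_sdiff hT]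

open Classical in
/-- Splitting the fillings according to the set `T` of the boxes which do not contain the largest
allowed value. -/
lemma boxSum_succ [DecidableEq β] (W S : β → β → Prop) (y : ℕ → β → R) (B : Finset β) (N : ℕ) :
    boxSum W S y B (N + 1) = ∑ T ∈ B.powerset with IsLevelSet W S B T,
      boxSum W S y T N * ∏ b ∈ B \ T, y N b := by
  let lev : (B → Fin (N + 1)) → Finset β := fun M => B.filter fun b =>
    ∃ h : b ∈ B, M ⟨b, h⟩ ≠ Fin.last N
  have hlev : ∀ M ∈ (Finset.univ : Finset (B → Fin (N + 1))), lev M ∈ B.powerset := fun M _ =>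
    Finset.mem_powerset.2 (Finset.filter_subset _ _)
  unfold boxSum fillSum
  rw [← Finset.sum_fiberwise_of_maps_to hlev, Finset.sum_filter]
  refine Finset.sum_congr rfl fun T hT => ?_
  have hT := Finset.mem_powerset.1 hT
  have key : ∑ M ∈ (Finset.univ : Finset (B → Fin (N + 1))) with lev M = T,
      (if Compatible (fun b c : B => W b.1 c.1) (fun b c => S b.1 c.1) M then
        ∏ b : B, y (M b) b.1 else 0) = ∑ M : T → Fin N,
      (if IsLevelSet W S B T ∧ Compatible (fun b c : T => W b.1 c.1) (fun b c => S b.1 c.1) M then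
        (∏ b : T, y (M b) b.1) * ∏ b ∈ B \ T, y N b else 0) := by
    symm
    refine Finset.sum_nbij (fun M => extendFilling M) (fun M _ => ?_) (fun M _ M' _ h => ?_)
      (fun M hM => ?_) fun M _ => ?_
    · simp only [Finset.mem_filter, Finset.mem_univ, true_and, lev]
      ext b
      simp only [Finset.mem_filter, extendFilling]
      constructor
      · rintro ⟨_, h, h'⟩
        by_contra hb
        simp [hb] at h'
      · intro hb
        refine ⟨hT hb, hT hb, ?_⟩
        simp only [hb, dif_pos]
        exact (Fin.castSucc_lt_last _).ne
    · funext b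
      have := congrFun h ⟨b.1, hT b.2⟩
      simpa [extendFilling] using this
    · have hM : lev M = T := by simpa using hM
      have hmem : ∀ b : B, b.1 ∈ T ↔ M b ≠ Fin.last N := by
        intro b
        rw [← hM]
        simp [lev]
      refine ⟨fun b => (M ⟨b.1, hT b.2⟩).castPred ((hmem _).1 b.2), by simp, ?_⟩
      funext b
      by_cases hb : b.1 ∈ T
      · simp [extendFilling, hb]
      · simp only [extendFilling, hb, dif_neg, not_false_eq_true]
        by_contra h
        exact hb ((hmem b).2 (Ne.symm h))
    · simp only [compatible_extendFilling hT M, prod_extendFilling hT]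
  rw [key]
  by_cases hI : IsLevelSet W S B T
  · simp only [hI, true_and, if_true, Finset.sum_mul, ite_mul, zero_mul]
  · simp [hI]

lemma boxSum_empty [DecidableEq β] (W S : β → β → Prop) (y : ℕ → β → R) (N : ℕ) :
    boxSum W S y ∅ N = 1 := by
  unfold boxSum fillSum
  rw [Finset.sum_eq_single_of_mem (fun b => absurd b.2 (Finset.notMem_empty _)) (Finset.mem_univ _)]
  · rw [if_pos ⟨fun b => absurd b.2 (Finset.notMem_empty _),
      fun b => absurd b.2 (Finset.notMem_empty _)⟩]
    simp
  · intro M _ hM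
    exact absurd (funext fun b => absurd b.2 (Finset.notMem_empty _)) hM

lemma boxSum_zero [DecidableEq β] (W S : β → β → Prop) (y : ℕ → β → R) {B : Finset β}
    (hB : B.Nonempty) :
    boxSum W S y B 0 = 0 := by
  unfold boxSum fillSum
  obtain ⟨b, hb⟩ := hB
  exact Finset.sum_eq_zero fun M _ => (M ⟨b, hb⟩).elim0

end Fillings

/-! ### Skew shapes in row coordinates -/

section Shapes

variable {R : Type*} [CommRing R] {r : ℕ}

/-- The boxes `(i, j)` with `mu i ≤ j < la i`. The position `j` in the row `i` is an integer, so that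
rows may start anywhere. -/
noncomputable def shapeBoxes (mu la : Fin r → ℤ) : Finset ((_ : Fin r) × ℤ) :=
  Finset.univ.sigma fun i => Finset.Ico (mu i) (la i)

@[simp]
lemma mem_shapeBoxes {mu la : Fin r → ℤ} {b : (_ : Fin r) × ℤ} :
    b ∈ shapeBoxes mu la ↔ mu b.1 ≤ b.2 ∧ b.2 < la b.1 := by
  simp [shapeBoxes]

/-- `c` lies in the same row as `b`, to the right of `b`. -/
def SameRow (b c : (_ : Fin r) × ℤ) : Prop := b.1 = c.1 ∧ b.2 < c.2

/-- `c` lies in the same column as `b`, below `b`. When a diagram is listed by columns instead of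
rows, the two relations change places. -/
def SameCol (b c : (_ : Fin r) × ℤ) : Prop := b.2 = c.2 ∧ b.1 < c.1

/-- The generating function of the fillings of the shape `la/mu` by `0, …, N - 1`, where the value
`m` in a box of content `k` has weight `x m k`. -/
noncomputable def shapeSum (W S : (_ : Fin r) × ℤ → (_ : Fin r) × ℤ → Prop) (x : ℕ → ℤ → R)
    (mu la : Fin r → ℤ) (N : ℕ) : R :=
  boxSum W S (fun m b => x m (b.2 - (b.1 : ℕ))) (shapeBoxes mu la) N

lemma shapeBoxes_subset {mu nu la : Fin r → ℤ} (h : nu ≤ la) :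
    shapeBoxes mu nu ⊆ shapeBoxes mu la := fun b hb => by
  have : nu b.1 ≤ la b.1 := h b.1
  simp only [mem_shapeBoxes] at hb ⊢
  omega

lemma shapeBoxes_sdiff {mu nu la : Fin r → ℤ} (h : mu ≤ nu) :
    shapeBoxes mu la \ shapeBoxes mu nu = shapeBoxes nu la := by
  ext b
  have : mu b.1 ≤ nu b.1 := h b.1
  simp only [Finset.mem_sdiff, mem_shapeBoxes]
  omega

lemma eq_of_shapeBoxes_eq {mu nu nu' : Fin r → ℤ} (h : mu ≤ nu) (h' : mu ≤ nu')
    (he : shapeBoxes mu nu = shapeBoxes mu nu') : nu = nu' := by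
  funext i
  have h1 := Finset.ext_iff.1 he ⟨i, nu i⟩
  have h2 := Finset.ext_iff.1 he ⟨i, nu' i⟩
  have : mu i ≤ nu i := h i
  have : mu i ≤ nu' i := h' i
  simp only [mem_shapeBoxes] at h1 h2
  omega

/-- A set of boxes closed under moving to the left within its row is itself a shape. -/
lemma exists_shapeBoxes_eq {mu la : Fin r → ℤ} (hml : mu ≤ la) {T : Finset ((_ : Fin r) × ℤ)}
    (hT : T ⊆ shapeBoxes mu la)
    (hleft : ∀ b ∈ shapeBoxes mu la, ∀ c ∈ T, SameRow b c → b ∈ T) :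
    ∃ nu, mu ≤ nu ∧ nu ≤ la ∧ shapeBoxes mu nu = T := by
  have key : ∀ i, ∃ k, (mu i ≤ k ∧ (⟨i, k⟩ : (_ : Fin r) × ℤ) ∉ T) ∧
      ∀ z, (mu i ≤ z ∧ (⟨i, z⟩ : (_ : Fin r) × ℤ) ∉ T) → k ≤ z := by
    intro i
    refine Int.exists_least_of_bdd ⟨mu i, fun z hz => hz.1⟩ ⟨la i, hml i, fun h => ?_⟩
    have := mem_shapeBoxes.1 (hT h)
    simp at this
  choose nu hnu hmin using key
  have hla : nu ≤ la := fun i => hmin i (la i) ⟨hml i, fun h => by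
    have := mem_shapeBoxes.1 (hT h)
    simp at this⟩
  refine ⟨nu, fun i => (hnu i).1, hla, ?_⟩
  ext ⟨i, j⟩
  constructor
  · intro h
    have h := mem_shapeBoxes.1 h
    by_contra hj
    exact absurd (hmin i j ⟨h.1, hj⟩) (not_le.2 h.2)
  · intro h
    have h1 := mem_shapeBoxes.1 (hT h)
    refine mem_shapeBoxes.2 ⟨h1.1, ?_⟩
    by_contra hj
    push Not at hj
    rcases hj.lt_or_eq with hj | hj
    · refine (hnu i).2 (hleft _ (mem_shapeBoxes.2 ⟨(hnu i).1, ?_⟩) _ h ⟨rfl, hj⟩)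
      exact hj.trans h1.2
    · have := (hnu i).2
      simp only at hj
      rw [hj] at this
      exact this h

/-- The general form of the recursion which removes the boxes with the largest value. -/
lemma shapeSum_succ {W S : (_ : Fin r) × ℤ → (_ : Fin r) × ℤ → Prop} (x : ℕ → ℤ → R)
    {mu la : Fin r → ℤ} (hml : mu ≤ la) (G : (Fin r → ℤ) → Prop) [DecidablePred G]
    (hG : ∀ nu, mu ≤ nu → nu ≤ la →
      (G nu ↔ IsLevelSet W S (shapeBoxes mu la) (shapeBoxes mu nu)))
    (hleft : ∀ T, IsLevelSet W S (shapeBoxes mu la) T →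
      ∀ b ∈ shapeBoxes mu la, ∀ c ∈ T, c ∈ shapeBoxes mu la → SameRow b c → b ∈ T) (N : ℕ) :
    shapeSum W S x mu la (N + 1) =
      ∑ nu ∈ Fintype.piFinset (fun i => Finset.Icc (mu i) (la i)) with G nu,
        shapeSum W S x mu nu N * ∏ i, ∏ j ∈ Finset.Ico (nu i) (la i), x N (j - (i : ℕ)) := by
  classical
  unfold shapeSum
  rw [boxSum_succ]
  symm
  refine Finset.sum_nbij (fun nu => shapeBoxes mu nu) (fun nu h => ?_) (fun nu h nu' h' he => ?_)
    (fun T hT => ?_) fun nu h => ?_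
  · simp only [Finset.mem_filter, Fintype.mem_piFinset, Finset.mem_Icc] at h
    simp only [Finset.mem_filter, Finset.mem_powerset]
    exact ⟨shapeBoxes_subset fun i => (h.1 i).2,
      (hG nu (fun i => (h.1 i).1) fun i => (h.1 i).2).1 h.2⟩
  · simp only [Finset.coe_filter, Set.mem_ofPred_eq, Fintype.mem_piFinset, Finset.mem_Icc] at h h'
    exact eq_of_shapeBoxes_eq (fun i => (h.1 i).1) (fun i => (h'.1 i).1) he
  · simp only [Finset.coe_filter, Set.mem_ofPred_eq, Finset.mem_powerset] at hT
    obtain ⟨nu, h1, h2, rfl⟩ := exists_shapeBoxes_eq hml hT.1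
      fun b hb c hc hbc => hleft T hT.2 b hb c hc (hT.1 hc) hbc
    refine ⟨nu, ?_, rfl⟩
    simp only [Finset.coe_filter, Set.mem_ofPred_eq, Fintype.mem_piFinset, Finset.mem_Icc]
    exact ⟨fun i => ⟨h1 i, h2 i⟩, (hG nu h1 h2).2 hT.2⟩
  · simp only [Finset.mem_filter, Fintype.mem_piFinset, Finset.mem_Icc] at h
    rw [shapeBoxes_sdiff fun i => (h.1 i).1]
    simp only [shapeBoxes]
    rw [Finset.prod_sigma]

/-- For rows weakly increasing and columns strictly increasing, the largest value fills a horizontal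
strip. -/
lemma isLevelSet_row_col_iff {mu nu la : Fin r → ℤ} (hmu : Antitone mu) (hla : Antitone la)
    (h1 : mu ≤ nu) :
    (∀ i i', i < i' → la i' ≤ nu i) ↔
      IsLevelSet SameRow SameCol (shapeBoxes mu la) (shapeBoxes mu nu) := by
  constructor
  · intro h
    refine ⟨?_, ?_⟩
    · rintro ⟨i, j⟩ hb ⟨i', j'⟩ hc ⟨rfl, hj⟩
      simp only [mem_shapeBoxes] at hb hc hj ⊢
      omega
    · rintro ⟨i, j⟩ hb ⟨i', j'⟩ hc ⟨rfl, hi⟩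
      have := h i i' hi
      simp only [mem_shapeBoxes] at hb hc ⊢
      omega
  · intro h i i' hi
    by_contra hlt
    push Not at hlt
    have : la i' ≤ la i := hla hi.le
    have : mu i' ≤ mu i := hmu hi.le
    have : mu i ≤ nu i := h1 i
    have := h.2 ⟨i, nu i⟩ (by simp only [mem_shapeBoxes]; omega) ⟨i', nu i⟩
      (by simp only [mem_shapeBoxes]; omega) ⟨rfl, hi⟩
    simp only [mem_shapeBoxes] at this
    omega

/-- For rows strictly increasing and columns weakly increasing, the largest value fills a vertical
strip. -/
lemma isLevelSet_col_row_iff {mu nu la : Fin r → ℤ} (hmu : Antitone mu) (hla : Antitone la)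
    (h1 : mu ≤ nu) (h2 : nu ≤ la) :
    ((∀ i, la i ≤ nu i + 1) ∧ Antitone nu) ↔
      IsLevelSet SameCol SameRow (shapeBoxes mu la) (shapeBoxes mu nu) := by
  constructor
  · rintro ⟨h, h'⟩
    refine ⟨?_, ?_⟩
    · rintro ⟨i, j⟩ hb ⟨i', j'⟩ hc ⟨rfl, hi⟩
      have : nu i' ≤ nu i := h' hi.le
      simp only [mem_shapeBoxes] at hb hc ⊢
      omega
    · rintro ⟨i, j⟩ hb ⟨i', j'⟩ hc ⟨rfl, hj⟩
      have := h i
      simp only [mem_shapeBoxes] at hb hc hj ⊢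
      omega
  · intro h
    refine ⟨fun i => ?_, fun i i' hi => ?_⟩
    · by_contra hlt
      push Not at hlt
      have : mu i ≤ nu i := h1 i
      have := h.2 ⟨i, nu i⟩ (by simp only [mem_shapeBoxes]; omega) ⟨i, nu i + 1⟩
        (by simp only [mem_shapeBoxes]; omega) ⟨rfl, by simp⟩
      simp only [mem_shapeBoxes] at this
      omega
    · by_contra hlt
      push Not at hlt
      have hne : i < i' := hi.lt_of_ne fun h => by subst h; exact lt_irrefl _ hlt
      have : la i' ≤ la i := hla hi
      have : mu i' ≤ mu i := hmu hi
      have : mu i ≤ nu i := h1 i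
      have : nu i' ≤ la i' := h2 i'
      have := h.1 ⟨i, nu i⟩ (by simp only [mem_shapeBoxes]; omega) ⟨i', nu i⟩
        (by simp only [mem_shapeBoxes]; omega) ⟨rfl, hne⟩
      simp only [mem_shapeBoxes] at this
      omega

open Classical in
lemma shapeSum_row_col_succ (x : ℕ → ℤ → R) {mu la : Fin r → ℤ} (hml : mu ≤ la)
    (hmu : Antitone mu) (hla : Antitone la) (N : ℕ) :
    shapeSum SameRow SameCol x mu la (N + 1) =
      ∑ nu ∈ Fintype.piFinset (fun i => Finset.Icc (mu i) (la i)) with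
        ∀ i i', i < i' → la i' ≤ nu i,
        shapeSum SameRow SameCol x mu nu N *
          ∏ i, ∏ j ∈ Finset.Ico (nu i) (la i), x N (j - (i : ℕ)) :=
  shapeSum_succ x hml _ (fun _ h1 _ => isLevelSet_row_col_iff hmu hla h1)
    (fun _ hT b hb c hc _ hbc => hT.1 b hb c hc hbc) N

open Classical in
lemma shapeSum_col_row_succ (x : ℕ → ℤ → R) {mu la : Fin r → ℤ} (hml : mu ≤ la)
    (hmu : Antitone mu) (hla : Antitone la) (N : ℕ) :
    shapeSum SameCol SameRow x mu la (N + 1) =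
      ∑ nu ∈ Fintype.piFinset (fun i => Finset.Icc (mu i) (la i)) with
        (∀ i, la i ≤ nu i + 1) ∧ Antitone nu,
        shapeSum SameCol SameRow x mu nu N *
          ∏ i, ∏ j ∈ Finset.Ico (nu i) (la i), x N (j - (i : ℕ)) :=
  shapeSum_succ x hml _ (fun _ h1 h2 => isLevelSet_col_row_iff hmu hla h1 h2)
    (fun _ hT b hb c _ hc hbc => hT.2 b hb c hc hbc) N

lemma shapeBoxes_self (mu : Fin r → ℤ) : shapeBoxes mu mu = ∅ := by
  ext b
  simp

lemma shapeSum_self (W S : (_ : Fin r) × ℤ → (_ : Fin r) × ℤ → Prop) (x : ℕ → ℤ → R)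
    (mu : Fin r → ℤ) (N : ℕ) : shapeSum W S x mu mu N = 1 := by
  rw [shapeSum, shapeBoxes_self, boxSum_empty]

lemma shapeSum_zero (W S : (_ : Fin r) × ℤ → (_ : Fin r) × ℤ → Prop) (x : ℕ → ℤ → R)
    {mu la : Fin r → ℤ} (hml : mu ≤ la) (hne : mu ≠ la) : shapeSum W S x mu la 0 = 0 := by
  obtain ⟨i, hi⟩ := Function.ne_iff.1 hne
  exact boxSum_zero _ _ _ ⟨⟨i, mu i⟩, mem_shapeBoxes.2 ⟨le_rfl, lt_of_le_of_ne (hml i) hi⟩⟩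

/-! ### Single rows -/

/-- The generating function of a single row with the contents `c, c + 1, …, l - 1`; it is `0` if
`l < c`. -/
noncomputable def rowSum (W S : (_ : Fin 1) × ℤ → (_ : Fin 1) × ℤ → Prop) (x : ℕ → ℤ → R)
    (N : ℕ) (c l : ℤ) : R :=
  if c ≤ l then shapeSum W S x (fun _ => c) (fun _ => l) N else 0

lemma rowSum_of_lt (W S : (_ : Fin 1) × ℤ → (_ : Fin 1) × ℤ → Prop) (x : ℕ → ℤ → R)
    (N : ℕ) {c l : ℤ} (h : l < c) : rowSum W S x N c l = 0 := if_neg (not_le.2 h)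

lemma rowSum_self (W S : (_ : Fin 1) × ℤ → (_ : Fin 1) × ℤ → Prop) (x : ℕ → ℤ → R)
    (N : ℕ) (c : ℤ) : rowSum W S x N c c = 1 := by
  rw [rowSum, if_pos le_rfl, shapeSum_self]

lemma rowSum_zero (W S : (_ : Fin 1) × ℤ → (_ : Fin 1) × ℤ → Prop) (x : ℕ → ℤ → R)
    (c l : ℤ) : rowSum W S x 0 c l = if c = l then 1 else 0 := by
  split_ifs with h
  · rw [h, rowSum_self]
  · unfold rowSum
    split_ifs with h'
    · exact shapeSum_zero _ _ _ (fun _ => h') fun he => h (congrFun he 0)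
    · rfl

lemma sum_piFinset_fin_one (f : (Fin 1 → ℤ) → R) (s : Finset ℤ) :
    ∑ nu ∈ Fintype.piFinset (fun _ : Fin 1 => s), f nu = ∑ k ∈ s, f fun _ => k := by
  refine Finset.sum_nbij' (fun nu => nu 0) (fun k _ => k) ?_ ?_ ?_ ?_ ?_
  · intro nu h
    exact Fintype.mem_piFinset.1 h 0
  · intro k hk
    exact Fintype.mem_piFinset.2 fun _ => hk
  · intro nu _
    funext i
    rw [Subsingleton.elim i 0]
  · intro k _
    rfl
  · intro nu _
    congr 1
    funext i
    rw [Subsingleton.elim i 0]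

lemma rowSum_weak_succ (x : ℕ → ℤ → R) (N : ℕ) {c l : ℤ} (h : c ≤ l) :
    rowSum SameRow SameCol x (N + 1) c l =
      ∑ k ∈ Finset.Icc c l, rowSum SameRow SameCol x N c k * ∏ j ∈ Finset.Ico k l, x N j := by
  classical
  rw [rowSum, if_pos h, shapeSum_row_col_succ x (fun _ => h) antitone_const antitone_const,
    Finset.filter_true_of_mem, sum_piFinset_fin_one]
  · refine Finset.sum_congr rfl fun k hk => ?_
    rw [rowSum, if_pos (Finset.mem_Icc.1 hk).1]
    simp
  · intro nu _ i i' hi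
    exact absurd (Subsingleton.elim i i') hi.ne

lemma rowSum_strict_succ (x : ℕ → ℤ → R) (N : ℕ) {c l : ℤ} (h : c ≤ l) :
    rowSum SameCol SameRow x (N + 1) c l =
      ∑ k ∈ Finset.Icc c l with l ≤ k + 1,
        rowSum SameCol SameRow x N c k * ∏ j ∈ Finset.Ico k l, x N j := by
  classical
  rw [rowSum, if_pos h, shapeSum_col_row_succ x (fun _ => h) antitone_const antitone_const,
    Finset.sum_filter, sum_piFinset_fin_one, Finset.sum_filter]
  refine Finset.sum_congr rfl fun k hk => ?_
  rw [rowSum, if_pos (Finset.mem_Icc.1 hk).1]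
  have : Antitone fun _ : Fin 1 => k := antitone_const
  simp [this]

/-- The last entry of a weakly increasing row either is not the largest value, or it is and can be
removed. -/
lemma rowSum_weak_step (x : ℕ → ℤ → R) (N : ℕ) (c l : ℤ) :
    rowSum SameRow SameCol x (N + 1) c (l + 1) =
      rowSum SameRow SameCol x N c (l + 1) + x N l * rowSum SameRow SameCol x (N + 1) c l := by
  rcases lt_trichotomy c (l + 1) with h | h | h
  · have hcl : c ≤ l := Int.lt_add_one_iff.1 h
    rw [rowSum_weak_succ x N h.le, rowSum_weak_succ x N hcl,
      ← Finset.insert_Icc_right_eq_Icc_add_one (a := c) (b := l) (by omega),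
      Finset.sum_insert (by simp), Finset.Ico_self, Finset.prod_empty, mul_one, Finset.mul_sum]
    congr 1
    refine Finset.sum_congr rfl fun k hk => ?_
    rw [← Finset.insert_Ico_right_eq_Ico_add_one (Finset.mem_Icc.1 hk).2,
      Finset.prod_insert (by simp)]
    ring
  · subst h
    rw [rowSum_self, rowSum_self, rowSum_of_lt _ _ _ _ (by omega), mul_zero, add_zero]
  · rw [rowSum_of_lt _ _ _ _ h, rowSum_of_lt _ _ _ _ h, rowSum_of_lt _ _ _ _ (by omega),
      mul_zero, add_zero]

/-- The last entry of a strictly increasing row either is not the largest value, or it is and what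
remains avoids that value. -/
lemma rowSum_strict_step (x : ℕ → ℤ → R) (N : ℕ) (c l : ℤ) :
    rowSum SameCol SameRow x (N + 1) c (l + 1) =
      rowSum SameCol SameRow x N c (l + 1) + x N l * rowSum SameCol SameRow x N c l := by
  rcases lt_trichotomy c (l + 1) with h | h | h
  · have hcl : c ≤ l := Int.lt_add_one_iff.1 h
    have hs : {k ∈ Finset.Icc c (l + 1) | l + 1 ≤ k + 1} = {l + 1, l} := by
      ext k
      simp only [Finset.mem_filter, Finset.mem_Icc, Finset.mem_insert, Finset.mem_singleton]
      omega
    have hl : Finset.Ico l (l + 1) = {l} := by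
      ext k
      simp only [Finset.mem_Ico, Finset.mem_singleton]
      omega
    rw [rowSum_strict_succ x N h.le, hs, Finset.sum_pair (by omega), Finset.Ico_self, hl,
      Finset.prod_empty, Finset.prod_singleton, mul_one, mul_comm (x N l)]
  · subst h
    rw [rowSum_self, rowSum_self, rowSum_of_lt _ _ _ _ (by omega), mul_zero, add_zero]
  · rw [rowSum_of_lt _ _ _ _ h, rowSum_of_lt _ _ _ _ h, rowSum_of_lt _ _ _ _ (by omega),
      mul_zero, add_zero]

end Shapes

/-! ### Determinants -/

section Determinants

variable {R : Type*} [CommRing R] {r : ℕ}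

lemma exists_mem_notMem_of_perm {α : Type*} (σ : Equiv.Perm α) {s : Finset α}
    {j : α} (hj : j ∉ s) (hσ : σ j ∈ s) : ∃ j' ∈ s, σ j' ∉ s := by
  by_contra! h
  have hsub : s.map σ.toEmbedding ⊆ s := fun a ha => by
    obtain ⟨b, hb, rfl⟩ := Finset.mem_map.1 ha
    exact h b hb
  have heq := Finset.eq_of_subset_of_card_le hsub (Finset.card_map _).ge
  rw [← heq] at hσ
  obtain ⟨b, hb, hbj⟩ := Finset.mem_map.1 hσ
  exact hj (σ.injective hbj ▸ hb)

lemma det_eq_zero_of_shift {p l : Fin r → ℤ} (hp : Antitone p) (hl : Antitone l)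
    {A : Matrix (Fin r) (Fin r) R} (hA : ∀ i j, l i < p j → A i j = 0) {i₀ : Fin r}
    (hi₀ : l i₀ < p i₀) : A.det = 0 := by
  rw [Matrix.det_apply]
  refine Finset.sum_eq_zero fun σ _ => ?_
  -- a permutation cannot send the `i₀ + 1` columns `j ≤ i₀` into the `i₀` rows above `i₀`
  obtain ⟨j, hj, hσ⟩ : ∃ j ≤ i₀, i₀ ≤ σ j := by
    by_contra! h
    have := Finset.card_le_card_of_injOn (s := Finset.Iic i₀) (t := Finset.Iio i₀) σ
      (fun j hj => by simpa using h j (by simpa using hj)) σ.injective.injOn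
    simp at this
  rw [Finset.prod_eq_zero (Finset.mem_univ j), smul_zero]
  exact hA _ _ ((hl hσ).trans_lt (hi₀.trans_le (hp hj)))

/-- Subtracting multiples of the next rows does not change the determinant. -/
lemma det_eq_of_row_eq_add_succ {A B : Matrix (Fin r) (Fin r) R} (c : Fin r → R)
    (hlast : ∀ (i : Fin r) j, (i : ℕ) + 1 = r → A i j = B i j)
    (hsucc : ∀ (i : Fin r) (h : (i : ℕ) + 1 < r) j, A i j = B i j + c i * A ⟨i + 1, h⟩ j) :
    A.det = B.det := by
  cases r with
  | zero => simp
  | succ n =>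
    rw [← Matrix.det_submatrix_equiv_self Fin.revPerm A,
      ← Matrix.det_submatrix_equiv_self Fin.revPerm B]
    refine Matrix.det_eq_of_forall_row_eq_smul_add_pred (fun i => c i.succ.rev) (fun j => ?_)
      fun i j => ?_
    · exact hlast _ _ (by simp)
    · have h : ((i.succ.rev : Fin (n + 1)) : ℕ) + 1 < n + 1 := by
        simp only [Fin.val_rev, Fin.val_succ]
        omega
      have h' : (⟨(i.succ.rev : Fin (n + 1)) + 1, h⟩ : Fin (n + 1)) = i.castSucc.rev := by
        ext
        simp only [Fin.val_rev, Fin.val_succ, Fin.val_castSucc]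
        omega
      simp only [Matrix.submatrix_apply, Fin.revPerm_apply]
      rw [hsucc _ h, h']

/-- Expansion of a determinant all of whose rows are given as linear combinations. -/
lemma det_sum_rows (K : Fin r → Finset ℤ) (t : Fin r → ℤ → R) (v : Fin r → ℤ → Fin r → R) :
    (Matrix.of fun i j => ∑ k ∈ K i, t i k * v i k j).det =
      ∑ nu ∈ Fintype.piFinset K, (∏ i, t i (nu i)) * (Matrix.of fun i j => v i (nu i) j).det := by
  have h1 : (Matrix.of fun i j => ∑ k ∈ K i, t i k * v i k j) =
      fun i => ∑ k ∈ K i, t i k • v i k := by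
    funext i j
    simp [Finset.sum_apply]
  rw [h1]
  change (Matrix.detRowAlternating (R := R) (n := Fin r)).toMultilinearMap _ = _
  rw [MultilinearMap.map_sum_finset]
  refine Finset.sum_congr rfl fun nu _ => ?_
  rw [MultilinearMap.map_smul_univ]
  rfl

/-- The Jacobi-Trudi matrix built from the series `g c l` of the rows with contents
`c, …, l - 1`. -/
def jtMatrix (g : ℤ → ℤ → R) (mu la : Fin r → ℤ) : Matrix (Fin r) (Fin r) R :=
  Matrix.of fun i j => g (mu j - (j : ℕ)) (la i - (i : ℕ))

lemma antitone_sub_val {nu : Fin r → ℤ} (h : Antitone nu) :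
    Antitone fun i => nu i - ((i : ℕ) : ℤ) := fun i i' hi => by
  have h1 : nu i' ≤ nu i := h hi
  have h2 : (i : ℕ) ≤ i' := hi
  simp only
  omega

lemma det_jtMatrix_eq_zero {g : ℤ → ℤ → R} (hg : ∀ c l, l < c → g c l = 0) {mu nu : Fin r → ℤ}
    (hmu : Antitone mu) (hnu : Antitone nu) (h : ¬ mu ≤ nu) : (jtMatrix g mu nu).det = 0 := by
  obtain ⟨i, hi⟩ := not_forall.1 h
  refine det_eq_zero_of_shift (antitone_sub_val hmu) (antitone_sub_val hnu)
    (fun i j hij => hg _ _ hij) (i₀ := i) ?_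
  exact sub_lt_sub_right (not_le.1 hi) _

/-- Without any allowed values, both sides of the Jacobi-Trudi identity count the empty filling. -/
lemma det_jtMatrix_delta {g : ℤ → ℤ → R} (hg : ∀ c l, g c l = if c = l then 1 else 0)
    {mu la : Fin r → ℤ} (hml : mu ≤ la) (hmu : Antitone mu) :
    (jtMatrix g mu la).det = if mu = la then 1 else 0 := by
  split_ifs with h
  · subst h
    have : jtMatrix g mu mu = 1 := by
      ext i j
      rw [Matrix.one_apply, jtMatrix, Matrix.of_apply, hg]
      refine if_congr ⟨fun he => ?_, fun he => by rw [he]⟩ rfl rfl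
      rcases lt_trichotomy i j with hij | hij | hij
      · have h1 : mu j ≤ mu i := hmu hij.le
        have h2 : (i : ℕ) < j := hij
        omega
      · exact hij
      · have h1 : mu i ≤ mu j := hmu hij.le
        have h2 : (j : ℕ) < i := hij
        omega
    rw [this, Matrix.det_one]
  · rw [Matrix.det_apply]
    refine Finset.sum_eq_zero fun σ _ => ?_
    suffices ∃ j, mu j - ((j : ℕ) : ℤ) ≠ la (σ j) - ((σ j : ℕ) : ℤ) by
      obtain ⟨j, hj⟩ := this
      rw [Finset.prod_eq_zero (Finset.mem_univ j), smul_zero]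
      rw [jtMatrix, Matrix.of_apply, hg, if_neg hj]
    by_contra! hσ
    have h1 : ∑ j, (mu j - ((j : ℕ) : ℤ)) = ∑ j, (la j - ((j : ℕ) : ℤ)) := by
      rw [← Equiv.sum_comp σ fun j => la j - ((j : ℕ) : ℤ)]
      exact Finset.sum_congr rfl fun j _ => hσ j
    rw [Finset.sum_sub_distrib, Finset.sum_sub_distrib, sub_left_inj,
      Finset.sum_eq_sum_iff_of_le fun i _ => hml i] at h1
    exact h (funext fun i => h1 i (Finset.mem_univ i))

lemma rowSum_weak_window (x : ℕ → ℤ → R) (N : ℕ) (c i : ℤ) {m n : ℤ} (h : m ≤ n) :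
    rowSum SameRow SameCol x (N + 1) c (n - i) =
      ∑ k ∈ Finset.Icc m n,
        (∏ j ∈ Finset.Ico k n, x N (j - i)) * rowSum SameRow SameCol x N c (k - i) +
      (∏ j ∈ Finset.Ico m n, x N (j - i)) * x N (m - i - 1) *
        rowSum SameRow SameCol x (N + 1) c (m - i - 1) := by
  induction n, h using Int.leInduction with
  | base =>
    have := rowSum_weak_step x N c (m - i - 1)
    rw [sub_add_cancel] at this
    simp [this]
  | succ n hn ih =>
    have := rowSum_weak_step x N c (n - i)
    rw [← sub_add_eq_add_sub, this, ih,
      ← Finset.insert_Icc_right_eq_Icc_add_one (a := m) (b := n) (by omega),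
      Finset.sum_insert (by simp), Finset.Ico_self, Finset.prod_empty, one_mul,
      ← Finset.insert_Ico_right_eq_Ico_add_one hn, Finset.prod_insert (by simp),
      mul_add, Finset.mul_sum, ← add_assoc, sub_add_eq_add_sub]
    congr 1
    · congr 1
      refine Finset.sum_congr rfl fun k hk => ?_
      rw [← Finset.insert_Ico_right_eq_Ico_add_one (Finset.mem_Icc.1 hk).2,
        Finset.prod_insert (by simp)]
      ring
    · ring

/-- The Jacobi-Trudi identity of type `H` with bounded entries. -/
theorem shapeSum_eq_det_weak (x : ℕ → ℤ → R) (N : ℕ) {mu la : Fin r → ℤ} (hml : mu ≤ la)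
    (hmu : Antitone mu) (hla : Antitone la) :
    shapeSum SameRow SameCol x mu la N =
      (jtMatrix (rowSum SameRow SameCol x N) mu la).det := by
  classical
  induction N generalizing la with
  | zero =>
    rw [det_jtMatrix_delta (rowSum_zero _ _ x) hml hmu]
    split_ifs with h
    · rw [h, shapeSum_self]
    · exact shapeSum_zero _ _ _ hml h
  | succ N ih =>
    -- `m i` is the least end of the row `i` after the removal of a horizontal strip
    let m : Fin r → ℤ := fun i => if h : (i : ℕ) + 1 < r then la ⟨i + 1, h⟩ else mu i
    have hm : ∀ i, m i ≤ la i := fun i => by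
      simp only [m]
      split_ifs with h
      · exact hla (Fin.mk_le_mk.2 (Nat.le_succ _) : i ≤ ⟨i + 1, h⟩)
      · exact hml i
    have hdet : (jtMatrix (rowSum SameRow SameCol x (N + 1)) mu la).det =
        (Matrix.of fun i j => ∑ k ∈ Finset.Icc (m i) (la i),
          (∏ j ∈ Finset.Ico k (la i), x N (j - (i : ℕ))) *
            rowSum SameRow SameCol x N (mu j - (j : ℕ)) (k - (i : ℕ))).det := by
      refine det_eq_of_row_eq_add_succ
        (fun i => (∏ j ∈ Finset.Ico (m i) (la i), x N (j - (i : ℕ))) * x N (m i - (i : ℕ) - 1))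
        (fun (i : Fin r) j hi => ?_) fun i hi j => ?_
      · rw [jtMatrix, Matrix.of_apply, Matrix.of_apply, rowSum_weak_window x N _ _ (hm i),
          rowSum_of_lt _ _ _ _ (l := m i - (i : ℕ) - 1), mul_zero, add_zero]
        have h1 : m i = mu i := dif_neg (by omega)
        have h2 : (j : ℕ) ≤ i := by omega
        have h3 : mu i ≤ mu j := hmu h2
        omega
      · rw [jtMatrix, Matrix.of_apply, Matrix.of_apply, rowSum_weak_window x N _ _ (hm i),
          Matrix.of_apply]
        have h1 : m i = la ⟨i + 1, hi⟩ := dif_pos hi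
        congr 3
        rw [h1]
        push_cast
        ring
    rw [hdet, det_sum_rows (fun i => Finset.Icc (m i) (la i))
      (fun i k => ∏ j ∈ Finset.Ico k (la i), x N (j - (i : ℕ)))
      (fun i k j => rowSum SameRow SameCol x N (mu j - (j : ℕ)) (k - (i : ℕ))),
      shapeSum_row_col_succ x hml hmu hla]
    have hanti : ∀ {nu : Fin r → ℤ}, nu ≤ la → (∀ i i', i < i' → la i' ≤ nu i) → Antitone nu := by
      intro nu h1 h2 i i' hi
      rcases hi.eq_or_lt with rfl | hi
      · exact le_rfl
      · exact (h1 i').trans (h2 i i' hi)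
    refine (Finset.sum_congr rfl fun nu hnu => ?_).trans
      (Finset.sum_subset (fun nu hnu => ?_) fun nu hnu hnu' => ?_)
    · simp only [Finset.mem_filter, Fintype.mem_piFinset, Finset.mem_Icc] at hnu
      rw [ih (fun i => (hnu.1 i).1) (hanti (fun i => (hnu.1 i).2) hnu.2), mul_comm]
      rfl
    · simp only [Finset.mem_filter, Fintype.mem_piFinset, Finset.mem_Icc] at hnu ⊢
      refine fun i => ⟨?_, (hnu.1 i).2⟩
      simp only [m]
      split_ifs with h
      · exact hnu.2 i _ (Fin.mk_lt_mk.2 (Nat.lt_succ_self _) : i < ⟨i + 1, h⟩)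
      · exact (hnu.1 i).1
    · simp only [Finset.mem_filter, Fintype.mem_piFinset, Finset.mem_Icc] at hnu hnu'
      have h2 : ∀ i i', i < i' → la i' ≤ nu i := by
        intro i i' hi
        have hr : (i : ℕ) + 1 < r := lt_of_le_of_lt (Nat.succ_le_of_lt hi) i'.2
        have h3 : m i = la ⟨i + 1, hr⟩ := dif_pos hr
        have h4 : la i' ≤ la ⟨i + 1, hr⟩ := hla (Nat.succ_le_of_lt hi : (i : ℕ) + 1 ≤ i')
        exact h4.trans (h3 ▸ (hnu i).1)
      have h3 : ¬ mu ≤ nu := fun h => hnu' ⟨fun i => ⟨h i, (hnu i).2⟩, h2⟩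
      have := det_jtMatrix_eq_zero (fun c l h => rowSum_of_lt SameRow SameCol x N h) hmu
        (hanti (fun i => (hnu i).2) h2) h3
      rw [jtMatrix] at this
      rw [this, mul_zero]

/-- The Jacobi-Trudi identity of type `E` with bounded entries. -/
theorem shapeSum_eq_det_strict (x : ℕ → ℤ → R) (N : ℕ) {mu la : Fin r → ℤ} (hml : mu ≤ la)
    (hmu : Antitone mu) (hla : Antitone la) :
    shapeSum SameCol SameRow x mu la N =
      (jtMatrix (rowSum SameCol SameRow x N) mu la).det := by
  classical
  induction N generalizing la with
  | zero =>
    rw [det_jtMatrix_delta (rowSum_zero _ _ x) hml hmu]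
    split_ifs with h
    · rw [h, shapeSum_self]
    · exact shapeSum_zero _ _ _ hml h
  | succ N ih =>
    have hmat : jtMatrix (rowSum SameCol SameRow x (N + 1)) mu la =
        Matrix.of fun i j => ∑ k ∈ Finset.Icc (la i - 1) (la i),
          (∏ j ∈ Finset.Ico k (la i), x N (j - (i : ℕ))) *
            rowSum SameCol SameRow x N (mu j - (j : ℕ)) (k - (i : ℕ)) := by
      ext i j
      have h1 : Finset.Icc (la i - 1) (la i) = {la i, la i - 1} := by
        ext k
        simp only [Finset.mem_Icc, Finset.mem_insert, Finset.mem_singleton]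
        omega
      have h2 : Finset.Ico (la i - 1) (la i) = {la i - 1} := by
        ext k
        simp only [Finset.mem_Ico, Finset.mem_singleton]
        omega
      have h3 := rowSum_strict_step x N (mu j - (j : ℕ)) (la i - 1 - (i : ℕ))
      rw [show la i - 1 - ((i : ℕ) : ℤ) + 1 = la i - (i : ℕ) by ring] at h3
      rw [jtMatrix, Matrix.of_apply, Matrix.of_apply, h1, Finset.sum_pair (by omega), h2,
        Finset.Ico_self, Finset.prod_empty, Finset.prod_singleton, one_mul, h3]
    rw [hmat, det_sum_rows (fun i => Finset.Icc (la i - 1) (la i))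
      (fun i k => ∏ j ∈ Finset.Ico k (la i), x N (j - (i : ℕ)))
      (fun i k j => rowSum SameCol SameRow x N (mu j - (j : ℕ)) (k - (i : ℕ))),
      shapeSum_col_row_succ x hml hmu hla]
    refine (Finset.sum_congr rfl fun nu hnu => ?_).trans
      (Finset.sum_subset (fun nu hnu => ?_) fun nu hnu hnu' => ?_)
    · simp only [Finset.mem_filter, Fintype.mem_piFinset, Finset.mem_Icc] at hnu
      rw [ih (fun i => (hnu.1 i).1) hnu.2.2, mul_comm]
      rfl
    · simp only [Finset.mem_filter, Fintype.mem_piFinset, Finset.mem_Icc] at hnu ⊢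
      exact fun i => ⟨by have := hnu.2.1 i; omega, (hnu.1 i).2⟩
    · simp only [Finset.mem_filter, Fintype.mem_piFinset, Finset.mem_Icc] at hnu hnu'
      by_cases h2 : Antitone nu
      · have h3 : ¬ mu ≤ nu := fun h => hnu' ⟨fun i => ⟨h i, (hnu i).2⟩,
          fun i => by have := (hnu i).1; omega, h2⟩
        have := det_jtMatrix_eq_zero (fun c l h => rowSum_of_lt SameCol SameRow x N h) hmu h2 h3
        rw [jtMatrix] at this
        rw [this, mul_zero]
      · -- a box removed above a box which is kept produces two equal rows
        cases r with
        | zero => exact absurd (fun i => i.elim0) h2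
        | succ n =>
          rw [Fin.antitone_iff_succ_le] at h2
          push Not at h2
          obtain ⟨i, hi⟩ := h2
          have h3 : la i.succ ≤ la i.castSucc := hla i.castSucc_lt_succ.le
          have h4 := (hnu i.castSucc).1
          have h5 := (hnu i.succ).2
          rw [Matrix.det_zero_of_row_eq i.castSucc_lt_succ.ne, mul_zero]
          funext j
          simp only [Matrix.of_apply, Fin.val_castSucc, Fin.val_succ]
          congr 1
          push_cast
          omega

end Determinants

open Filter Topology

/-! ### Absolute convergence -/

section Convergence

variable {ι : Type*} [Fintype ι]

lemma summable_prod_of_summable {f : ℕ+ → ℝ} (hf : Summable f) (h0 : ∀ m, 0 ≤ f m) :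
    Summable fun M : ι → ℕ+ => ∏ b, f (M b) := by
  classical
  refine summable_of_sum_le (c := ∏ _b : ι, ∑' m, f m)
    (fun M => Finset.prod_nonneg fun b _ => h0 _) fun u => ?_
  let t : ι → Finset ℕ+ := fun b => u.image fun M => M b
  calc ∑ M ∈ u, ∏ b, f (M b) ≤ ∑ M ∈ Fintype.piFinset t, ∏ b, f (M b) :=
        Finset.sum_le_sum_of_subset_of_nonneg
          (fun M hM => Fintype.mem_piFinset.2 fun b => Finset.mem_image_of_mem _ hM)
          fun M _ _ => Finset.prod_nonneg fun b _ => h0 _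
    _ = ∏ b, ∑ m ∈ t b, f m := (Finset.prod_univ_sum t fun _ m => f m).symm
    _ ≤ ∏ _b : ι, ∑' m, f m := Finset.prod_le_prod
        (fun b _ => Finset.sum_nonneg fun m _ => h0 m)
        fun b _ => hf.sum_le_tsum _ fun m _ => h0 m

lemma summable_pnat_rpow {e : ℝ} (he : 1 < e) : Summable fun m : ℕ+ => ((m : ℕ) : ℝ) ^ (-e) := by
  have h : Summable fun n : ℕ => (n : ℝ) ^ (-e) := Real.summable_nat_rpow.2 (by linarith)
  exact h.comp_injective PNat.coe_injective

lemma norm_one_div_prod_cpow (s : ι → ℂ) (M : ι → ℕ+) :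
    ‖1 / ∏ b, ((M b : ℕ) : ℂ) ^ (s b)‖ =
      Real.exp (-∑ b, (s b).re * Real.log (M b : ℕ)) := by
  rw [norm_div, norm_one, norm_prod, Real.exp_neg, one_div, Real.exp_sum]
  congr 1
  refine Finset.prod_congr rfl fun b _ => ?_
  rw [Complex.norm_natCast_cpow_of_pos (M b).pos,
    Real.rpow_def_of_pos (by exact_mod_cast (M b).pos), mul_comm]

/-- A sum over fillings converges absolutely if all exponents have real part at least `1` and every
entry is bounded by an entry whose exponent has real part greater than `1`: the excess of the latter
can be distributed over all boxes. -/
lemma summable_of_le_excess (s : ι → ℂ) (hs : ∀ b, 1 ≤ (s b).re) (c : ι → ι)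
    (hc : ∀ b, 1 < (s (c b)).re) (P : (ι → ℕ+) → Prop) (hP : ∀ M, P M → ∀ b, M b ≤ M (c b)) :
    Summable fun M : {M // P M} => ‖1 / ∏ b, ((M.1 b : ℕ) : ℂ) ^ (s b)‖ := by
  obtain ⟨ε, hε, hεc⟩ : ∃ ε : ℝ, 0 < ε ∧
      ∀ b, (Fintype.card ι : ℝ) * ε ≤ (s (c b)).re - 1 := by
    cases isEmpty_or_nonempty ι with
    | inl h => exact ⟨1, one_pos, fun b => h.elim b⟩
    | inr h =>
      obtain ⟨b₀, hb₀⟩ := Finite.exists_min fun b => (s (c b)).re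
      have hn : (0 : ℝ) < Fintype.card ι := by exact_mod_cast Fintype.card_pos
      refine ⟨((s (c b₀)).re - 1) / Fintype.card ι, div_pos (by linarith [hc b₀]) hn,
        fun b => ?_⟩
      rw [mul_div_cancel₀ _ hn.ne']
      linarith [hb₀ b]
  have hsum := (summable_prod_of_summable (ι := ι)
    (summable_pnat_rpow (e := 1 + ε) (by linarith)) fun m => by positivity).comp_injective
    (Subtype.val_injective (p := P))
  refine hsum.of_nonneg_of_le (fun _ => norm_nonneg _) fun M => ?_
  have hlog : ∀ b, 0 ≤ Real.log (M.1 b : ℕ) := fun b =>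
    Real.log_nonneg (by exact_mod_cast (M.1 b).pos)
  have hprod : ((fun M : ι → ℕ+ => ∏ b, ((M b : ℕ) : ℝ) ^ (-(1 + ε))) ∘ Subtype.val) M =
      Real.exp (-∑ b, (1 + ε) * Real.log (M.1 b : ℕ)) := by
    rw [← Finset.sum_neg_distrib, Real.exp_sum]
    refine Finset.prod_congr rfl fun b _ => ?_
    rw [Real.rpow_def_of_pos (by exact_mod_cast (M.1 b).pos)]
    congr 1
    ring
  rw [hprod, norm_one_div_prod_cpow, Real.exp_le_exp, neg_le_neg_iff]
  set E := ∑ b, ((s b).re - 1) * Real.log (M.1 b : ℕ) with hE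
  have hterm : ∀ b, (Fintype.card ι : ℝ) * (ε * Real.log (M.1 b : ℕ)) ≤ E := by
    intro b
    have hle : Real.log (M.1 b : ℕ) ≤ Real.log (M.1 (c b) : ℕ) :=
      Real.log_le_log (by exact_mod_cast (M.1 b).pos) (by exact_mod_cast hP M.1 M.2 b)
    calc (Fintype.card ι : ℝ) * (ε * Real.log (M.1 b : ℕ))
        ≤ (Fintype.card ι : ℝ) * (ε * Real.log (M.1 (c b) : ℕ)) := by gcongr
      _ = (Fintype.card ι : ℝ) * ε * Real.log (M.1 (c b) : ℕ) := by ring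
      _ ≤ ((s (c b)).re - 1) * Real.log (M.1 (c b) : ℕ) :=
          mul_le_mul_of_nonneg_right (hεc b) (hlog _)
      _ ≤ E := Finset.single_le_sum
          (f := fun b => ((s b).re - 1) * Real.log (M.1 b : ℕ))
          (fun b _ => mul_nonneg (by linarith [hs b]) (hlog b)) (Finset.mem_univ _)
  have hE' : ∑ b, ε * Real.log (M.1 b : ℕ) ≤ E := by
    cases isEmpty_or_nonempty ι with
    | inl h => simp [hE]
    | inr h =>
      have hn : (0 : ℝ) < Fintype.card ι := by exact_mod_cast Fintype.card_pos
      refine le_of_mul_le_mul_left ?_ hn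
      rw [Finset.mul_sum]
      calc _ ≤ ∑ _b : ι, E := Finset.sum_le_sum fun b _ => hterm b
        _ = _ := by simp
  have h1 : ∑ b, (1 + ε) * Real.log (M.1 b : ℕ) =
      ∑ b, Real.log (M.1 b : ℕ) + ∑ b, ε * Real.log (M.1 b : ℕ) := by
    rw [← Finset.sum_add_distrib]
    exact Finset.sum_congr rfl fun b _ => by ring
  have h2 : ∑ b, (s b).re * Real.log (M.1 b : ℕ) = ∑ b, Real.log (M.1 b : ℕ) + E := by
    rw [hE, ← Finset.sum_add_distrib]
    exact Finset.sum_congr rfl fun b _ => by ring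
  linarith

lemma mzetaStarConverges_of_re {n : ℕ} (s : Fin n → ℂ) (hs : ∀ k, 1 ≤ (s k).re)
    (hlast : ∀ k : Fin n, (k : ℕ) + 1 = n → 1 < (s k).re) : MzetaStarConverges s := by
  cases n with
  | zero => exact summable_of_le_excess s hs id (fun b => b.elim0) _ fun _ _ _ => le_rfl
  | succ n =>
    exact summable_of_le_excess s hs (fun _ => Fin.last n) (fun _ => hlast _ (by simp)) _
      fun M hM b => hM (Fin.le_last b)

lemma mzetaConverges_of_re {n : ℕ} (s : Fin n → ℂ) (hs : ∀ k, 1 ≤ (s k).re)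
    (hlast : ∀ k : Fin n, (k : ℕ) + 1 = n → 1 < (s k).re) : MzetaConverges s := by
  cases n with
  | zero => exact summable_of_le_excess s hs id (fun b => b.elim0) _ fun _ _ _ => le_rfl
  | succ n =>
    exact summable_of_le_excess s hs (fun _ => Fin.last n) (fun _ => hlast _ (by simp)) _
      fun M hM b => hM.monotone (Fin.le_last b)

/-- Moving to the right or down as long as possible leads to a corner, and the entries do not
decrease on the way. -/
lemma exists_corner_le {lam mu : YoungDiagram} (b : {b : ℕ × ℕ // b ∈ skewCells lam mu}) :
    ∃ c : {b : ℕ × ℕ // b ∈ skewCells lam mu}, IsCorner lam mu c.1 ∧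
      ∀ M : SkewTableau lam mu ℕ+, IsSemistandard M → M b ≤ M c := by
  classical
  let t : Finset {b : ℕ × ℕ // b ∈ skewCells lam mu} :=
    Finset.univ.filter fun c => ∀ M : SkewTableau lam mu ℕ+, IsSemistandard M → M b ≤ M c
  obtain ⟨c, hc, hmax⟩ := t.exists_max_image (fun c => c.1.1 + c.1.2)
    ⟨b, by simp [t]⟩
  simp only [t, Finset.mem_filter, Finset.mem_univ, true_and] at hc hmax
  refine ⟨c, ⟨c.2, fun h => ?_, fun h => ?_⟩, hc⟩
  · have := hmax ⟨_, h⟩ fun M hM =>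
      (hc M hM).trans (hM.2 c ⟨_, h⟩ rfl (Nat.lt_succ_self _)).le
    simp only at this
    omega
  · have := hmax ⟨_, h⟩ fun M hM =>
      (hc M hM).trans (hM.1 c ⟨_, h⟩ rfl (Nat.lt_succ_self _))
    simp only at this
    omega

lemma one_le_re_of_mem_convergenceRegion {lam mu : YoungDiagram} {s : SkewTableau lam mu ℂ}
    (hs : s ∈ convergenceRegion lam mu) (b : {b : ℕ × ℕ // b ∈ skewCells lam mu}) :
    1 ≤ (s b).re := by
  by_cases h : IsCorner lam mu b.1
  · exact (hs.2 b h).le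
  · exact hs.1 b h

lemma summable_norm_schurTerm {lam mu : YoungDiagram} {s : SkewTableau lam mu ℂ}
    (hs : s ∈ convergenceRegion lam mu) : Summable fun M => ‖schurTerm s M‖ := by
  choose c hc hle using exists_corner_le (lam := lam) (mu := mu)
  exact summable_of_le_excess s (one_le_re_of_mem_convergenceRegion hs) c
    (fun b => hs.2 _ (hc b)) _ fun M hM b => hle b M hM

/-! ### Limits of the truncated sums -/

/-- An absolutely convergent sum over compatible fillings by positive integers is the limit of the
sums over the fillings by `1, …, N`. -/
lemma tendsto_fillSum [DecidableEq ι] {W S : ι → ι → Prop} {P : (ι → ℕ+) → Prop}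
    (hP : ∀ M, P M ↔ Compatible W S M) (s : ι → ℂ)
    (hsum : Summable fun M : {M // P M} => ‖1 / ∏ b, ((M.1 b : ℕ) : ℂ) ^ (s b)‖) :
    Tendsto (fillSum W S fun m b => 1 / ((m + 1 : ℕ) : ℂ) ^ (s b)) atTop
      (𝓝 (∑' M : {M // P M}, 1 / ∏ b, ((M.1 b : ℕ) : ℂ) ^ (s b))) := by
  classical
  have hcomp : ∀ {N : ℕ} {M : ι → Fin N}, Compatible W S M →
      P fun b => (M b : ℕ).succPNat := by
    intro N M h
    refine (hP _).2 ⟨fun b c hbc => ?_, fun b c hbc => ?_⟩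
    · exact Nat.succPNat_le_succPNat.2 (h.1 b c hbc)
    · exact Nat.succPNat_lt_succPNat.2 (h.2 b c hbc)
  let j : ∀ N, {M : ι → Fin N // Compatible W S M} → {M // P M} := fun N M =>
    ⟨fun b => (M.1 b : ℕ).succPNat, hcomp M.2⟩
  have hj : ∀ N, Function.Injective (j N) := by
    intro N M M' h
    refine Subtype.ext (funext fun b => Fin.ext ?_)
    exact Nat.succPNat_injective (congrFun (congrArg Subtype.val h) b)
  let t : ℕ → Finset {M // P M} := fun N => Finset.univ.map ⟨j N, hj N⟩
  have ht : ∀ N M, M ∈ t N ↔ ∀ b, (M.1 b : ℕ) ≤ N := by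
    intro N M
    simp only [t, Finset.mem_map, Finset.mem_univ, true_and, Function.Embedding.coeFn_mk]
    constructor
    · rintro ⟨M', rfl⟩ b
      exact (M'.1 b).2
    · intro h
      refine ⟨⟨fun b => ⟨(M.1 b).natPred, ?_⟩, ?_⟩, ?_⟩
      · have := (M.1 b).natPred_add_one
        have := h b
        omega
      · have hM := (hP _).1 M.2
        exact ⟨fun b c hbc => PNat.natPred_le_natPred.2 (hM.1 b c hbc),
          fun b c hbc => PNat.natPred_lt_natPred.2 (hM.2 b c hbc)⟩
      · exact Subtype.ext (funext fun b => PNat.succPNat_natPred _)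
  have hlim : Tendsto t atTop atTop := by
    refine tendsto_atTop_finset_of_monotone (fun N N' h M hM => ?_) fun M => ?_
    · exact (ht _ _).2 fun b => ((ht _ _).1 hM b).trans h
    · exact ⟨∑ b, (M.1 b : ℕ), (ht _ _).2 fun b =>
        Finset.single_le_sum (f := fun b => (M.1 b : ℕ)) (fun _ _ => Nat.zero_le _)
          (Finset.mem_univ b)⟩
  have hval : ∀ N, fillSum W S (fun m b => 1 / ((m + 1 : ℕ) : ℂ) ^ (s b)) N =
      ∑ M ∈ t N, 1 / ∏ b, ((M.1 b : ℕ) : ℂ) ^ (s b) := by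
    intro N
    simp only [t, Finset.sum_map, Function.Embedding.coeFn_mk]
    rw [fillSum, ← Finset.sum_filter, Finset.sum_subtype _ (p := Compatible W S) (by simp)]
    refine Finset.sum_congr rfl fun M _ => ?_
    simp [j]
  rw [funext hval]
  exact hsum.of_norm.hasSum.comp hlim

/-- The positions of a single row, numbered from `0`. -/
def rowEquiv (c l : ℤ) :
    Fin (l - c).toNat ≃ shapeBoxes (r := 1) (fun _ => c) fun _ => l where
  toFun k := ⟨⟨0, c + (k : ℕ)⟩, by
    have := k.2
    simp only [mem_shapeBoxes]
    omega⟩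
  invFun b := ⟨(b.1.2 - c).toNat, by
    have := mem_shapeBoxes.1 b.2
    omega⟩
  left_inv k := by
    ext
    simp
  right_inv b := by
    have := mem_shapeBoxes.1 b.2
    refine Subtype.ext (Sigma.ext (Subsingleton.elim _ _) (heq_of_eq ?_))
    simp only
    omega

lemma sameRow_rowEquiv {c l : ℤ} (k k' : Fin (l - c).toNat) :
    SameRow (rowEquiv c l k).1 (rowEquiv c l k').1 ↔ k < k' := by
  simp [SameRow, rowEquiv]

lemma not_sameCol_fin_one (b c : (_ : Fin 1) × ℤ) : ¬ SameCol b c := fun h =>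
  h.2.ne (Subsingleton.elim _ _)

lemma tendsto_rowSum_weak (a : ℤ → ℂ) (c l : ℤ)
    (h : MzetaStarConverges (ascTuple a c (l - c))) :
    Tendsto (fun N => rowSum SameRow SameCol (fun m k => 1 / ((m + 1 : ℕ) : ℂ) ^ (a k)) N c l)
      atTop (𝓝 (starEntry a c (l - c))) := by
  unfold starEntry
  split_ifs with h1 h2
  · simp only [rowSum_of_lt _ _ _ _ (show l < c by omega)]
    exact tendsto_const_nhds
  · obtain rfl : c = l := by omega
    simp only [rowSum_self]
    exact tendsto_const_nhds
  · refine (tendsto_fillSum (W := fun k k' => k < k') (S := fun _ _ => False)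
      (P := Monotone) (fun M => ?_) (ascTuple a c (l - c)) h).congr fun N => ?_
    · rw [Compatible, monotone_iff_forall_lt]
      simp
    · rw [rowSum, if_pos (by omega), shapeSum, boxSum]
      refine fillSum_congr (rowEquiv c l) (fun k k' => (sameRow_rowEquiv k k').symm)
        (fun k k' => ⟨False.elim, not_sameCol_fin_one _ _⟩) (fun m k => ?_) N
      simp [rowEquiv, ascTuple]

lemma tendsto_rowSum_strict (a : ℤ → ℂ) (c l : ℤ)
    (h : MzetaConverges (descTuple a (-c) (l - c))) :
    Tendsto (fun N => rowSum SameCol SameRow (fun m k => 1 / ((m + 1 : ℕ) : ℂ) ^ (a (-k))) N c l)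
      atTop (𝓝 (zetaEntry a (-c) (l - c))) := by
  unfold zetaEntry
  split_ifs with h1 h2
  · simp only [rowSum_of_lt _ _ _ _ (show l < c by omega)]
    exact tendsto_const_nhds
  · obtain rfl : c = l := by omega
    simp only [rowSum_self]
    exact tendsto_const_nhds
  · refine (tendsto_fillSum (W := fun _ _ => False) (S := fun k k' => k < k')
      (P := StrictMono) (fun M => ?_) (descTuple a (-c) (l - c)) h).congr fun N => ?_
    · simp [Compatible, StrictMono]
    · rw [rowSum, if_pos (by omega), shapeSum, boxSum]
      refine fillSum_congr (rowEquiv c l) (fun k k' => ⟨False.elim, not_sameCol_fin_one _ _⟩)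
        (fun k k' => (sameRow_rowEquiv k k').symm) (fun m k => ?_) N
      simp only [rowEquiv, descTuple, Equiv.coe_fn_mk, Fin.val_zero, Nat.cast_zero, sub_zero]
      rw [neg_add']

/-! ### Entries which do not contribute to the determinant -/

/-- The entry `(i, j)` involves an index `k` which does not occur in any row `p m, …, l m - 1`. -/
def InvolvesGap {r : ℕ} (p l : Fin r → ℤ) (i j : Fin r) : Prop :=
  ∃ k, p j ≤ k ∧ k < l i ∧ ∀ m, l m ≤ k ∨ k < p m

/-- A gap `k` makes the matrix block triangular, the blocks being given by `k < p m`, and an entry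
which involves `k` lies in the block that does not matter. -/
lemma det_congr_of_gap {R : Type*} [CommRing R] {r : ℕ} {p l : Fin r → ℤ}
    {A B : Matrix (Fin r) (Fin r) R} (hA : ∀ i j, l i < p j → A i j = 0)
    (hB : ∀ i j, l i < p j → B i j = 0) (hAB : ∀ i j, ¬ InvolvesGap p l i j → A i j = B i j) :
    A.det = B.det := by
  rw [Matrix.det_apply, Matrix.det_apply]
  refine Finset.sum_congr rfl fun σ _ => congrArg _ ?_
  by_cases h : ∃ j, InvolvesGap p l (σ j) j
  · obtain ⟨j, k, hjk, hkσ, hk⟩ := h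
    obtain ⟨j', hj', hσ⟩ := exists_mem_notMem_of_perm σ
      (s := Finset.univ.filter fun m => k < p m) (j := j) (by simpa using hjk)
      (by simpa using (hk (σ j)).resolve_left (not_le.2 hkσ))
    simp only [Finset.mem_filter, Finset.mem_univ, true_and] at hj' hσ
    have hlt : l (σ j') < p j' := ((hk (σ j')).resolve_right hσ).trans_lt hj'
    have hA0 : ∏ i, A (σ i) i = 0 := Finset.prod_eq_zero (Finset.mem_univ j') (hA _ _ hlt)
    have hB0 : ∏ i, B (σ i) i = 0 := Finset.prod_eq_zero (Finset.mem_univ j') (hB _ _ hlt)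
    rw [hA0, hB0]
  · push Not at h
    exact Finset.prod_congr rfl fun j _ => hAB _ _ (h j)

lemma tendsto_det_of_gap {r : ℕ} {p l : Fin r → ℤ} {A : ℕ → Matrix (Fin r) (Fin r) ℂ}
    {B : Matrix (Fin r) (Fin r) ℂ} (hA : ∀ N i j, l i < p j → A N i j = 0)
    (hB : ∀ i j, l i < p j → B i j = 0)
    (hAB : ∀ i j, ¬ InvolvesGap p l i j → Tendsto (fun N => A N i j) atTop (𝓝 (B i j))) :
    Tendsto (fun N => (A N).det) atTop (𝓝 B.det) := by
  classical
  let cut : Matrix (Fin r) (Fin r) ℂ → Matrix (Fin r) (Fin r) ℂ := fun C =>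
    Matrix.of fun i j => if InvolvesGap p l i j then 0 else C i j
  have hcut : ∀ C : Matrix (Fin r) (Fin r) ℂ, (∀ i j, l i < p j → C i j = 0) →
      C.det = (cut C).det := fun C hC =>
    det_congr_of_gap hC (fun i j h => by simp [cut, hC i j h]) fun i j h => by simp [cut, h]
  have hlim : Tendsto (fun N => cut (A N)) atTop (𝓝 (cut B)) := by
    refine tendsto_pi_nhds.2 fun i => tendsto_pi_nhds.2 fun j => ?_
    by_cases h : InvolvesGap p l i j
    · simp only [cut, Matrix.of_apply, h, if_true]
      exact tendsto_const_nhds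
    · simpa only [cut, Matrix.of_apply, h, if_false] using hAB i j h
  rw [hcut B hB]
  refine Tendsto.congr (fun N => (hcut (A N) (hA N)).symm) ?_
  exact ((continuous_id.matrix_det).tendsto (cut B)).comp hlim

/-- If the last content of the row `i` of `la` occurs in any row of the shape `la/mu`, then the row
`i` of `la/mu` is nonempty, so that this content is the one of its last box. -/
lemma lt_of_last_mem_row {r : ℕ} {mu la : Fin r → ℤ} (hmu : Antitone mu) (hla : Antitone la)
    {i m : Fin r} (h1 : mu m - (m : ℕ) ≤ la i - (i : ℕ) - 1)
    (h2 : la i - (i : ℕ) - 1 < la m - (m : ℕ)) : mu i < la i := by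
  rcases le_or_gt m i with h | h
  · have h3 : mu i ≤ mu m := hmu h
    have h4 : (m : ℕ) ≤ i := h
    omega
  · have h3 : la m ≤ la i := hla h.le
    have h4 : (i : ℕ) < m := h
    omega

end Convergence

/-! ### Young diagrams -/

section Diagrams

variable {lam mu : YoungDiagram}

lemma mem_skewCells_iff_rowLen {b : ℕ × ℕ} :
    b ∈ skewCells lam mu ↔ mu.rowLen b.1 ≤ b.2 ∧ b.2 < lam.rowLen b.1 := by
  rw [skewCells, Finset.mem_sdiff, YoungDiagram.mem_cells, YoungDiagram.mem_cells,
    ← Prod.mk.eta (p := b), YoungDiagram.mem_iff_lt_rowLen, YoungDiagram.mem_iff_lt_rowLen]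
  simp only
  omega

lemma mem_skewCells_iff_colLen {b : ℕ × ℕ} :
    b ∈ skewCells lam mu ↔ mu.colLen b.2 ≤ b.1 ∧ b.1 < lam.colLen b.2 := by
  rw [skewCells, Finset.mem_sdiff, YoungDiagram.mem_cells, YoungDiagram.mem_cells,
    ← Prod.mk.eta (p := b), YoungDiagram.mem_iff_lt_colLen, YoungDiagram.mem_iff_lt_colLen]
  simp only
  omega

lemma fst_lt_colLen_zero {b : ℕ × ℕ} (hb : b ∈ skewCells lam mu) : b.1 < lam.colLen 0 := by
  have := (mem_skewCells_iff_colLen.1 hb).2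
  exact this.trans_le (lam.colLen_anti _ _ (Nat.zero_le _))

lemma snd_lt_rowLen_zero {b : ℕ × ℕ} (hb : b ∈ skewCells lam mu) : b.2 < lam.rowLen 0 := by
  have := (mem_skewCells_iff_rowLen.1 hb).2
  exact this.trans_le (lam.rowLen_anti _ _ (Nat.zero_le _))

/-- The lengths of the first `r` rows. -/
def rowLens (nu : YoungDiagram) (r : ℕ) (i : Fin r) : ℤ := nu.rowLen i

/-- The lengths of the first `q` columns. -/
def colLens (nu : YoungDiagram) (q : ℕ) (i : Fin q) : ℤ := nu.colLen i

lemma antitone_rowLens (nu : YoungDiagram) (r : ℕ) : Antitone (rowLens nu r) := fun _ _ h =>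
  Nat.cast_le.2 (nu.rowLen_anti _ _ h)

lemma antitone_colLens (nu : YoungDiagram) (q : ℕ) : Antitone (colLens nu q) := fun _ _ h =>
  Nat.cast_le.2 (nu.colLen_anti _ _ h)

lemma rowLens_le (h : mu ≤ lam) (r : ℕ) : rowLens mu r ≤ rowLens lam r := fun i => by
  refine Nat.cast_le.2 (le_of_forall_lt fun j hj => ?_)
  exact YoungDiagram.mem_iff_lt_rowLen.1 (h (YoungDiagram.mem_iff_lt_rowLen.2 hj))

lemma colLens_le (h : mu ≤ lam) (q : ℕ) : colLens mu q ≤ colLens lam q := fun i => by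
  refine Nat.cast_le.2 (le_of_forall_lt fun j hj => ?_)
  exact YoungDiagram.mem_iff_lt_colLen.1 (h (YoungDiagram.mem_iff_lt_colLen.2 hj))

/-- The boxes of `lam/mu`, listed by rows. -/
def cellsEquivRows {r : ℕ} (hr : lam.colLen 0 ≤ r) :
    {b : ℕ × ℕ // b ∈ skewCells lam mu} ≃ shapeBoxes (rowLens mu r) (rowLens lam r) where
  toFun b := ⟨⟨⟨b.1.1, (fst_lt_colLen_zero b.2).trans_le hr⟩, b.1.2⟩, by
    have := mem_skewCells_iff_rowLen.1 b.2
    simp only [mem_shapeBoxes, rowLens]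
    omega⟩
  invFun b := ⟨(b.1.1, b.1.2.toNat), by
    have := mem_shapeBoxes.1 b.2
    simp only [mem_skewCells_iff_rowLen, rowLens] at this ⊢
    omega⟩
  left_inv b := by simp
  right_inv b := by
    have := mem_shapeBoxes.1 b.2
    simp only [rowLens] at this
    refine Subtype.ext (Sigma.ext rfl (heq_of_eq ?_))
    simp only
    omega

/-- The boxes of `lam/mu`, listed by columns. -/
def cellsEquivCols {q : ℕ} (hq : lam.rowLen 0 ≤ q) :
    {b : ℕ × ℕ // b ∈ skewCells lam mu} ≃ shapeBoxes (colLens mu q) (colLens lam q) where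
  toFun b := ⟨⟨⟨b.1.2, (snd_lt_rowLen_zero b.2).trans_le hq⟩, b.1.1⟩, by
    have := mem_skewCells_iff_colLen.1 b.2
    simp only [mem_shapeBoxes, colLens]
    omega⟩
  invFun b := ⟨(b.1.2.toNat, b.1.1), by
    have := mem_shapeBoxes.1 b.2
    simp only [mem_skewCells_iff_colLen, colLens] at this ⊢
    omega⟩
  left_inv b := by simp
  right_inv b := by
    have := mem_shapeBoxes.1 b.2
    simp only [colLens] at this
    refine Subtype.ext (Sigma.ext rfl (heq_of_eq ?_))
    simp only
    omega

lemma isContent_iff_row {r : ℕ} (hr : lam.colLen 0 ≤ r) (k : ℤ) :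
    IsContent lam mu k ↔
      ∃ m : Fin r, rowLens mu r m - (m : ℕ) ≤ k ∧ k < rowLens lam r m - (m : ℕ) := by
  constructor
  · rintro ⟨b, hb, rfl⟩
    have := mem_skewCells_iff_rowLen.1 hb
    refine ⟨⟨b.1, (fst_lt_colLen_zero hb).trans_le hr⟩, ?_⟩
    simp only [rowLens, content]
    omega
  · rintro ⟨m, h1, h2⟩
    simp only [rowLens] at h1 h2
    refine ⟨((m : ℕ), (k + (m : ℕ)).toNat), mem_skewCells_iff_rowLen.2 ?_, ?_⟩
    · simp only
      omega
    · simp only [content]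
      omega

lemma isContent_neg_iff_col {q : ℕ} (hq : lam.rowLen 0 ≤ q) (k : ℤ) :
    IsContent lam mu (-k) ↔
      ∃ m : Fin q, colLens mu q m - (m : ℕ) ≤ k ∧ k < colLens lam q m - (m : ℕ) := by
  constructor
  · rintro ⟨b, hb, hk⟩
    have := mem_skewCells_iff_colLen.1 hb
    refine ⟨⟨b.2, (snd_lt_rowLen_zero hb).trans_le hq⟩, ?_⟩
    simp only [colLens, content] at hk ⊢
    omega
  · rintro ⟨m, h1, h2⟩
    simp only [colLens] at h1 h2
    refine ⟨((k + (m : ℕ)).toNat, (m : ℕ)), mem_skewCells_iff_colLen.2 ?_, ?_⟩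
    · simp only
      omega
    · simp only [content]
      omega

variable {s : SkewTableau lam mu ℂ} {a : ℤ → ℂ}

lemma one_le_re_of_isContent (hs : s ∈ convergenceRegion lam mu)
    (ha : ∀ b, a (content b.1) = s b) {k : ℤ} (hk : IsContent lam mu k) : 1 ≤ (a k).re := by
  obtain ⟨b, hb, rfl⟩ := hk
  rw [ha ⟨b, hb⟩]
  exact one_le_re_of_mem_convergenceRegion hs _

lemma mzetaStarConverges_entry {r : ℕ} (hr : lam.colLen 0 ≤ r)
    (hs : s ∈ convergenceRegion lam mu) (ha : ∀ b, a (content b.1) = s b)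
    (hend : ∀ b, b.1.2 + 1 = lam.rowLen b.1.1 → 1 < (s b).re) (i j : Fin r)
    (hk : ∀ k : ℤ, 0 ≤ k → k < rowLength lam mu i j → IsContent lam mu (rowStart mu j + k)) :
    MzetaStarConverges (ascTuple a (rowStart mu j) (rowLength lam mu i j)) := by
  refine mzetaStarConverges_of_re _ (fun k => ?_) fun k hlast => ?_
  · have := k.2
    exact one_le_re_of_isContent hs ha (hk _ (by omega) (by omega))
  · have hk2 := k.2
    have hcont := hk k (by omega) (by omega)
    obtain ⟨m, h1, h2⟩ := (isContent_iff_row hr _).1 hcont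
    -- the last index of the tuple is the content of the last box of the row `i`
    have hidx : rowStart mu j + (k : ℕ) = rowLens lam r i - (i : ℕ) - 1 := by
      simp only [rowStart, rowLength, rowLens] at *
      omega
    rw [hidx] at h1 h2
    have hne := lt_of_last_mem_row (antitone_rowLens mu r) (antitone_rowLens lam r) h1 h2
    simp only [rowLens] at hne hidx
    have hb : ((i : ℕ), lam.rowLen i - 1) ∈ skewCells lam mu := by
      rw [mem_skewCells_iff_rowLen]
      simp only
      omega
    have hc : content ((i : ℕ), lam.rowLen i - 1) = rowStart mu j + (k : ℕ) := by
      simp only [content]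
      omega
    rw [ascTuple, ← hc, ha ⟨_, hb⟩]
    refine hend _ ?_
    simp only
    omega

lemma mzetaConverges_entry {q : ℕ} (hq : lam.rowLen 0 ≤ q)
    (hs : s ∈ convergenceRegion lam mu) (ha : ∀ b, a (content b.1) = s b)
    (hend : ∀ b, b.1.1 + 1 = lam.colLen b.1.2 → 1 < (s b).re) (i j : Fin q)
    (hk : ∀ k : ℤ, 0 ≤ k → k < colLength lam mu i j → IsContent lam mu (colStart mu j - k)) :
    MzetaConverges (descTuple a (colStart mu j) (colLength lam mu i j)) := by
  refine mzetaConverges_of_re _ (fun k => ?_) fun k hlast => ?_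
  · have := k.2
    exact one_le_re_of_isContent hs ha (hk _ (by omega) (by omega))
  · have hk2 := k.2
    have hcont := hk k (by omega) (by omega)
    -- the last index of the tuple is the content of the last box of the column `i`
    have hidx : colStart mu j - (k : ℕ) = -(colLens lam q i - (i : ℕ) - 1) := by
      simp only [colStart, colLength, colLens] at *
      omega
    rw [hidx] at hcont
    obtain ⟨m, h1, h2⟩ := (isContent_neg_iff_col hq _).1 hcont
    have hne := lt_of_last_mem_row (antitone_colLens mu q) (antitone_colLens lam q) h1 h2
    simp only [colLens] at hne hidx
    have hb : (lam.colLen i - 1, (i : ℕ)) ∈ skewCells lam mu := by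
      rw [mem_skewCells_iff_colLen]
      simp only
      omega
    have hc : content (lam.colLen i - 1, (i : ℕ)) = colStart mu j - (k : ℕ) := by
      simp only [content]
      omega
    rw [descTuple, ← hc, ha ⟨_, hb⟩]
    refine hend _ ?_
    simp only
    omega

lemma isSemistandard_iff_compatible (M : SkewTableau lam mu ℕ+) :
    IsSemistandard M ↔ Compatible (fun b c => b.1.1 = c.1.1 ∧ b.1.2 < c.1.2)
      (fun b c => b.1.2 = c.1.2 ∧ b.1.1 < c.1.1) M := by
  simp only [IsSemistandard, Compatible, and_imp]

lemma tendsto_shapeSum_rows {r : ℕ} (hr : lam.colLen 0 ≤ r) (hs : s ∈ convergenceRegion lam mu)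
    (ha : ∀ b, a (content b.1) = s b) :
    Tendsto (shapeSum SameRow SameCol (fun m k => 1 / ((m + 1 : ℕ) : ℂ) ^ (a k))
      (rowLens mu r) (rowLens lam r)) atTop (𝓝 (schurZeta s)) := by
  refine (tendsto_fillSum isSemistandard_iff_compatible _
    (summable_norm_schurTerm hs)).congr fun N => ?_
  rw [shapeSum, boxSum]
  refine fillSum_congr (cellsEquivRows hr) (fun b c => ?_) (fun b c => ?_) (fun m b => ?_) N
  · simp only [SameRow, cellsEquivRows, Equiv.coe_fn_mk, Fin.mk.injEq, Nat.cast_lt]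
  · simp only [SameCol, cellsEquivRows, Equiv.coe_fn_mk, Fin.mk_lt_mk, Nat.cast_inj]
  · rw [← ha b]
    rfl

lemma tendsto_shapeSum_cols {q : ℕ} (hq : lam.rowLen 0 ≤ q) (hs : s ∈ convergenceRegion lam mu)
    (ha : ∀ b, a (content b.1) = s b) :
    Tendsto (shapeSum SameCol SameRow (fun m k => 1 / ((m + 1 : ℕ) : ℂ) ^ (a (-k)))
      (colLens mu q) (colLens lam q)) atTop (𝓝 (schurZeta s)) := by
  refine (tendsto_fillSum isSemistandard_iff_compatible _
    (summable_norm_schurTerm hs)).congr fun N => ?_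
  rw [shapeSum, boxSum]
  refine fillSum_congr (cellsEquivCols hq) (fun b c => ?_) (fun b c => ?_) (fun m b => ?_) N
  · simp only [SameCol, cellsEquivCols, Equiv.coe_fn_mk, Fin.mk_lt_mk, Nat.cast_inj]
  · simp only [SameRow, cellsEquivCols, Equiv.coe_fn_mk, Fin.mk.injEq, Nat.cast_lt]
  · rw [← ha b]
    simp [cellsEquivCols, content]

/-- The Jacobi-Trudi formula of type `H`. -/
theorem schurZeta_eq_det_hMatrix (hmu : mu ≤ lam) {r : ℕ} (hr : lam.colLen 0 ≤ r)
    (hs : s ∈ convergenceRegion lam mu) (ha : ∀ b, a (content b.1) = s b)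
    (hend : ∀ b, b.1.2 + 1 = lam.rowLen b.1.1 → 1 < (s b).re) :
    schurZeta s = (hMatrix lam mu r a).det := by
  refine tendsto_nhds_unique (tendsto_shapeSum_rows hr hs ha) ?_
  refine Tendsto.congr (fun N => (shapeSum_eq_det_weak _ N (rowLens_le hmu r)
    (antitone_rowLens mu r) (antitone_rowLens lam r)).symm) ?_
  have hlen : ∀ i j : Fin r, rowLength lam mu i j =
      rowLens lam r i - (i : ℕ) - rowStart mu j := fun i j => by
    simp only [rowLength, rowLens, rowStart]
    ring
  refine tendsto_det_of_gap (p := fun j => rowLens mu r j - (j : ℕ))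
    (l := fun i => rowLens lam r i - (i : ℕ)) (fun N i j h => rowSum_of_lt _ _ _ _ h)
    (fun i j h => if_pos ?_) fun i j h => ?_
  · rw [hlen]
    exact sub_neg.2 h
  · rw [hMatrix, Matrix.of_apply, hlen]
    refine tendsto_rowSum_weak a (rowStart mu j) (rowLens lam r i - (i : ℕ)) ?_
    rw [← hlen]
    refine mzetaStarConverges_entry hr hs ha hend i j fun k hk1 hk2 => ?_
    rw [isContent_iff_row hr]
    by_contra! hgap
    rw [hlen] at hk2
    refine h ⟨rowStart mu j + k, ?_, by beta_reduce; omega, fun m => ?_⟩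
    · simp only [rowStart, rowLens]
      omega
    · exact (lt_or_ge (rowStart mu j + k) (rowLens mu r m - (m : ℕ))).symm.imp_left (hgap m)

/-- The Jacobi-Trudi formula of type `E`. -/
theorem schurZeta_eq_det_eMatrix (hmu : mu ≤ lam) {q : ℕ} (hq : lam.rowLen 0 ≤ q)
    (hs : s ∈ convergenceRegion lam mu) (ha : ∀ b, a (content b.1) = s b)
    (hend : ∀ b, b.1.1 + 1 = lam.colLen b.1.2 → 1 < (s b).re) :
    schurZeta s = (eMatrix lam mu q a).det := by
  refine tendsto_nhds_unique (tendsto_shapeSum_cols hq hs ha) ?_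
  refine Tendsto.congr (fun N => (shapeSum_eq_det_strict _ N (colLens_le hmu q)
    (antitone_colLens mu q) (antitone_colLens lam q)).symm) ?_
  have hlen : ∀ i j : Fin q, colLength lam mu i j =
      colLens lam q i - (i : ℕ) - (colLens mu q j - (j : ℕ)) := fun i j => by
    simp only [colLength, colLens]
    ring
  have hstart : ∀ j : Fin q, colStart mu j = -(colLens mu q j - (j : ℕ)) := fun j => by
    simp only [colStart, colLens]
    ring
  refine tendsto_det_of_gap (p := fun j => colLens mu q j - (j : ℕ))
    (l := fun i => colLens lam q i - (i : ℕ)) (fun N i j h => rowSum_of_lt _ _ _ _ h)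
    (fun i j h => if_pos ?_) fun i j h => ?_
  · rw [hlen]
    exact sub_neg.2 h
  · rw [eMatrix, Matrix.of_apply, hlen, hstart]
    refine tendsto_rowSum_strict a (colLens mu q j - (j : ℕ)) (colLens lam q i - (i : ℕ)) ?_
    rw [← hlen, ← hstart]
    refine mzetaConverges_entry hq hs ha hend i j fun k hk1 hk2 => ?_
    rw [hstart, ← neg_add', isContent_neg_iff_col hq]
    by_contra! hgap
    rw [hlen] at hk2
    exact h ⟨colLens mu q j - (j : ℕ) + k, by beta_reduce; omega, by beta_reduce; omega,
      fun m =>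
        (lt_or_ge (colLens mu q j - (j : ℕ) + k) (colLens mu q m - (m : ℕ))).symm.imp_left
          (hgap m)⟩

end Diagrams

end SkewSchurZeta

theorem mainTheorem2 (lam mu : YoungDiagram) (hmu : mu ≤ lam) (r q : ℕ)
    (hr : lam.colLen 0 ≤ r) (hq : lam.rowLen 0 ≤ q)
    (s : SkewSchurZeta.SkewTableau lam mu ℂ)
    (hs : s ∈ SkewSchurZeta.diagConvergenceRegion lam mu)
    (a : ℤ → ℂ) (ha : ∀ b, a (SkewSchurZeta.content b.1) = s b) :
    (Summable fun M => ‖SkewSchurZeta.schurTerm s M‖) ∧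
    ((∀ b, b.1.2 + 1 = lam.rowLen b.1.1 → 1 < (s b).re) →
      (∀ i j : Fin r,
        (∀ k : ℤ, 0 ≤ k → k < SkewSchurZeta.rowLength lam mu i j →
          SkewSchurZeta.IsContent lam mu (SkewSchurZeta.rowStart mu j + k)) →
        SkewSchurZeta.MzetaStarConverges
          (SkewSchurZeta.ascTuple a (SkewSchurZeta.rowStart mu j)
            (SkewSchurZeta.rowLength lam mu i j))) ∧
      SkewSchurZeta.schurZeta s = (SkewSchurZeta.hMatrix lam mu r a).det) ∧
    ((∀ b, b.1.1 + 1 = lam.colLen b.1.2 → 1 < (s b).re) →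
      (∀ i j : Fin q,
        (∀ k : ℤ, 0 ≤ k → k < SkewSchurZeta.colLength lam mu i j →
          SkewSchurZeta.IsContent lam mu (SkewSchurZeta.colStart mu j - k)) →
        SkewSchurZeta.MzetaConverges
          (SkewSchurZeta.descTuple a (SkewSchurZeta.colStart mu j)
            (SkewSchurZeta.colLength lam mu i j))) ∧
      SkewSchurZeta.schurZeta s = (SkewSchurZeta.eMatrix lam mu q a).det) := by
  exact ⟨SkewSchurZeta.summable_norm_schurTerm hs.1,
    fun hend => ⟨SkewSchurZeta.mzetaStarConverges_entry hr hs.1 ha hend,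
      SkewSchurZeta.schurZeta_eq_det_hMatrix hmu hr hs.1 ha hend⟩,
    fun hend => ⟨SkewSchurZeta.mzetaConverges_entry hq hs.1 ha hend,
      SkewSchurZeta.schurZeta_eq_det_eMatrix hmu hq hs.1 ha hend⟩⟩
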